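/- Let $k_1,\dots,k_\ell\in\mathbb{R}$ and $n_1,\dots,n_\ell\in\mathbb{N}$. Let $\mathbb{O}_k^n$ be the model space form: $\mathbb{R}^n$ if $k=0$; the sphere $\{\langle x,x\rangle=1/k\}\subset\mathbb{R}^{n+1}$ if $k>0$; the sheet $\{\langle x,x\rangle=1/k,\ x_0>0\}$ of the hyperboloid in the Lorentz space $\mathbb{L}^{n+1}$ (with $\langle x,y\rangle=-x_0y_0+\sum_{j\ge1}x_jy_j$) if $k<0$. Let $\hat{\mathbb{O}}=\mathbb{O}_{k_1}^{n_1}\times\cdots\times\mathbb{O}_{k_\ell}^{n_\ell}$, a submanifold of the product $\mathbb{R}^N$ of the corresponding flat spaces, let $\pi_i$ be the orthogonal projection of $\mathbb{R}^N$ onto its $i$-th factor, and let $\bar\nabla$ be the Levi-Civita connection of $\hat{\mathbb{O}}$ (the component tangent to $\hat{\mathbb{O}}$ of the flat derivative). Let $M$ be a smooth Riemannian manifold with Levi-Civita connection $\nabla$ and curvature $\mathcal{R}(X,Y)Z=\nabla_X\nabla_YZ-\nabla_Y\nabla_XZ-\nabla_{[X,Y]}Z$, and let $f:M\to\hat{\mathbb{O}}$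 be a smooth isometric immersion, with normal bundle $T^\perp M$ (the orthogonal complement of $f_*TM$ in $T\hat{\mathbb{O}}$), normal connection $\nabla^\perp_X\xi=(\bar\nabla_X\xi)^\perp$ with curvature $\mathcal{R}^\perp$, second fundamental form $\alpha(X,Y)=(\bar\nabla_Xf_*Y)^\perp$, and shape operators $\langle A_\eta X,Y\rangle=\langle\alpha(X,Y),\eta\rangle$. For each $i$ put $\mathbf{L}_i=\pi_i\circ f_*:TM\to T\hat{\mathbb{O}}$, $\mathbf{K}_i=\pi_i|_{T^\perp M}:T^\perp M\to T\hat{\mathbb{O}}$ and, with ${}^t$ denoting the adjoint, $$\mathbf{R}_i=\mathbf{L}_i^t\mathbf{L}_i:TM\to TM,\qquad \mathbf{S}_i=\mathbf{K}_i^t\mathbf{L}_i:TM\to T^\perp M,\qquad \mathbf{T}_i=\mathbf{K}_i^t\mathbf{K}_i:T^\perp M\to T^\perp M.$$ Write $(A\wedge B)C=\langle B,C\rangle A-\langle A,C\rangle B$. Covariant derivatives of tensors are the usual ones: $(\nabla_X\mathbf{R}_i)Y=\nabla_X(\mathbf{R}_iY)-\mathbf{R}_i\nabla_XY$, $(\nabla_X\mathbf{S}_i)Y=\nabla^\perp_X(\mathbf{S}_iY)-\mathbf{S}_i\nabla_XY$,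 $(\nabla_X\mathbf{S}_i^t)\xi=\nabla_X(\mathbf{S}_i^t\xi)-\mathbf{S}_i^t\nabla^\perp_X\xi$, $(\nabla_X\mathbf{T}_i)\xi=\nabla^\perp_X(\mathbf{T}_i\xi)-\mathbf{T}_i\nabla^\perp_X\xi$, $(\nabla^\perp_X\alpha)(Y,Z)=\nabla^\perp_X\alpha(Y,Z)-\alpha(\nabla_XY,Z)-\alpha(Y,\nabla_XZ)$, $(\nabla_YA)(X,\xi)=\nabla_Y(A_\xi X)-A_\xi\nabla_YX-A_{\nabla^\perp_Y\xi}X$. Then for all smooth vector fields $X,Y,Z$ on $M$, all smooth normal fields $\xi,\zeta$ and all $i\in\{1,\dots,\ell\}$: $$(\nabla_X\mathbf{R}_i)Y=A_{\mathbf{S}_iY}X+\mathbf{S}_i^t\alpha(X,Y),$$ $$(\nabla_X\mathbf{S}_i)Y=\mathbf{T}_i\alpha(X,Y)-\alpha(X,\mathbf{R}_iY),\qquad(\nabla_X\mathbf{S}_i^t)\xi=A_{\mathbf{T}_i\xi}X-\mathbf{R}_iA_\xi X,$$ $$(\nabla_X\mathbf{T}_i)\xi=-\mathbf{S}_iA_\xi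 X-\alpha(X,\mathbf{S}_i^t\xi);$$ the Gauss equation $$\mathcal{R}(X,Y)Z=\sum_{i=1}^\ell k_i(\mathbf{R}_iX\wedge\mathbf{R}_iY)Z+A_{\alpha(Y,Z)}X-A_{\alpha(X,Z)}Y;$$ the Codazzi equations $$(\nabla^\perp_X\alpha)(Y,Z)-(\nabla^\perp_Y\alpha)(X,Z)=\sum_{i=1}^\ell k_i\big[\langle\mathbf{R}_iY,Z\rangle\mathbf{S}_iX-\langle\mathbf{R}_iX,Z\rangle\mathbf{S}_iY\big],$$ $$(\nabla_YA)(X,\xi)-(\nabla_XA)(Y,\xi)=\sum_{i=1}^\ell k_i\big[\langle\mathbf{S}_iY,\xi\rangle\mathbf{R}_iX-\langle\mathbf{S}_iX,\xi\rangle\mathbf{R}_iY\big];$$ and the Ricci equations $$\mathcal{R}^\perp(X,Y)\xi=\alpha(X,A_\xi Y)-\alpha(A_\xi X,Y)+\sum_{i=1}^\ell k_i(\mathbf{S}_iX\wedge\mathbf{S}_iY)\xi,$$ $$\langle\mathcal{R}^\perp(X,Y)\xi,\zeta\rangle=\langle[A_\xi,A_\zeta]X,Y\rangle+\Big\langle\sum_{i=1}^\ell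 k_i(\mathbf{S}_iX\wedge\mathbf{S}_iY)\xi,\zeta\Big\rangle.$$ -/

import Mathlib

open Bundle VectorField
open scoped Manifold ContDiff

namespace SpaceFormProduct

noncomputable section LeviCivita

variable {E : Type*} [NormedAddCommGroup E] [NormedSpace ℝ E]
  {H : Type*} [TopologicalSpace H] (I : ModelWithCorners ℝ E H)
  {M : Type*} [TopologicalSpace M] [ChartedSpace H M] [IsManifold I ∞ M]
  [RiemannianBundle (fun x : M ↦ TangentSpace I x)]

/-- The right-hand side of the Koszul formula. -/
def koszul (X Y W : Π x : M, TangentSpace I x) (x : M) : ℝ :=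
  mvfderiv I (fun y ↦ inner ℝ (Y y) (W y)) x (X x)
    + mvfderiv I (fun y ↦ inner ℝ (X y) (W y)) x (Y x)
    - mvfderiv I (fun y ↦ inner ℝ (X y) (Y y)) x (W x)
    + inner ℝ (mlieBracket I X Y x) (W x)
    - inner ℝ (mlieBracket I X W x) (Y x)
    - inner ℝ (mlieBracket I Y W x) (X x)

variable [IsContMDiffRiemannianBundle I ∞ E (fun x : M ↦ TangentSpace I x)]

theorem mdiffAt_inner {X Y : Π x : M, TangentSpace I x} {x : M}
    (hX : MDiffAt (T% X) x) (hY : MDiffAt (T% Y) x) :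
    MDiffAt (fun y ↦ inner ℝ (X y) (Y y)) x :=
  MDifferentiableAt.inner_bundle (E := (TangentSpace I : M → Type _)) hX hY

variable [FiniteDimensional ℝ E]

theorem koszul_tensorial_left {Y W : Π x : M, TangentSpace I x} {x : M}
    (hY : MDiffAt (T% Y) x) (hW : MDiffAt (T% W) x) :
    TensorialAt I E (fun X ↦ koszul I X Y W x) x where
  smul {g X} hg hX := by
    have e1 : (fun y ↦ inner ℝ ((g • X) y) (W y)) = fun y ↦ g y * inner ℝ (X y) (W y) := by
      ext y; simp [inner_smul_left]
    have e2 : (fun y ↦ inner ℝ ((g • X) y) (Y y)) = fun y ↦ g y * inner ℝ (X y) (Y y) := by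
      ext y; simp [inner_smul_left]
    simp only [koszul, e1, e2]
    rw [mvfderiv_fun_mul hg (mdiffAt_inner I hX hW), mvfderiv_fun_mul hg (mdiffAt_inner I hX hY),
      mlieBracket_smul_left hg hX, mlieBracket_smul_left hg hX]
    simp [inner_add_left, inner_smul_left, inner_smul_right, mvfderiv]
    ring
  add {X X'} hX hX' := by
    have e1 : (fun y ↦ inner ℝ ((X + X') y) (W y))
      = fun y ↦ inner ℝ (X y) (W y) + inner ℝ (X' y) (W y) := by
      ext y; simp [inner_add_left]
    have e2 : (fun y ↦ inner ℝ ((X + X') y) (Y y))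
      = fun y ↦ inner ℝ (X y) (Y y) + inner ℝ (X' y) (Y y) := by
      ext y; simp [inner_add_left]
    simp only [koszul, e1, e2]
    rw [mvfderiv_fun_add (mdiffAt_inner I hX hW) (mdiffAt_inner I hX' hW),
      mvfderiv_fun_add (mdiffAt_inner I hX hY) (mdiffAt_inner I hX' hY),
      mlieBracket_add_left hX hX', mlieBracket_add_left hX hX']
    simp [inner_add_left, inner_add_right]
    ring

theorem koszul_tensorial_right {X Y : Π x : M, TangentSpace I x} {x : M}
    (hX : MDiffAt (T% X) x) (hY : MDiffAt (T% Y) x) :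
    TensorialAt I E (fun W ↦ koszul I X Y W x) x where
  smul {g W} hg hW := by
    have e1 : (fun y ↦ inner ℝ (X y) ((g • W) y)) = fun y ↦ g y * inner ℝ (X y) (W y) := by
      ext y; simp [inner_smul_right]
    have e2 : (fun y ↦ inner ℝ (Y y) ((g • W) y)) = fun y ↦ g y * inner ℝ (Y y) (W y) := by
      ext y; simp [inner_smul_right]
    simp only [koszul, e1, e2]
    rw [mvfderiv_fun_mul hg (mdiffAt_inner I hX hW), mvfderiv_fun_mul hg (mdiffAt_inner I hY hW),
      mlieBracket_smul_right hg hW, mlieBracket_smul_right hg hW]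
    simp [inner_add_left, inner_smul_left, inner_smul_right, mvfderiv]
    rw [real_inner_comm (W x) (X x), real_inner_comm (W x) (Y x)]
    ring
  add {W W'} hW hW' := by
    have e1 : (fun y ↦ inner ℝ (X y) ((W + W') y))
      = fun y ↦ inner ℝ (X y) (W y) + inner ℝ (X y) (W' y) := by
      ext y; simp [inner_add_right]
    have e2 : (fun y ↦ inner ℝ (Y y) ((W + W') y))
      = fun y ↦ inner ℝ (Y y) (W y) + inner ℝ (Y y) (W' y) := by
      ext y; simp [inner_add_right]
    simp only [koszul, e1, e2]
    rw [mvfderiv_fun_add (mdiffAt_inner I hX hW) (mdiffAt_inner I hX hW'),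
      mvfderiv_fun_add (mdiffAt_inner I hY hW) (mdiffAt_inner I hY hW'),
      mlieBracket_add_right hW hW', mlieBracket_add_right hW hW']
    simp [inner_add_left, inner_add_right]
    ring


open Classical in
/-- The operator `(∇ Y)(x) : v ↦ ∇_v Y (x)` determined by the Koszul formula
`2 ⟪∇_X Y, W⟫ = koszul X Y W`. -/
def leviCivitaFun (Y : Π x : M, TangentSpace I x) (x : M) :
    TangentSpace I x →L[ℝ] TangentSpace I x :=
  have : FiniteDimensional ℝ (TangentSpace I x) := inferInstanceAs (FiniteDimensional ℝ E)
  have : CompleteSpace (TangentSpace I x) := FiniteDimensional.complete ℝ _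
  if hY : MDiffAt (T% Y) x then
    LinearMap.toContinuousLinearMap
      { toFun := fun v ↦ (1 / 2 : ℝ) • (InnerProductSpace.toDual ℝ (TangentSpace I x)).symm
          (TensorialAt.mkHom₂ (fun X W ↦ koszul I X Y W x) x
            (fun _ hW ↦ koszul_tensorial_left I hY hW)
            (fun _ hX ↦ koszul_tensorial_right I hX hY) v)
        map_add' := fun v w ↦ by simp
        map_smul' := fun c v ↦ by simp [smul_comm c] }
  else 0

theorem inner_leviCivitaFun {X Y W : Π x : M, TangentSpace I x} {x : M} (hX : MDiffAt (T% X) x)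
    (hY : MDiffAt (T% Y) x) (hW : MDiffAt (T% W) x) :
    inner ℝ (leviCivitaFun I Y x (X x)) (W x) = (1 / 2) * koszul I X Y W x := by
  have : FiniteDimensional ℝ (TangentSpace I x) := inferInstanceAs (FiniteDimensional ℝ E)
  have : CompleteSpace (TangentSpace I x) := FiniteDimensional.complete ℝ _
  have h := TensorialAt.mkHom₂_apply (fun _ hW ↦ koszul_tensorial_left I hY hW)
    (fun _ hX ↦ koszul_tensorial_right I hX hY) hX hW
  simp only [leviCivitaFun, hY, dif_pos, LinearMap.coe_toContinuousLinearMap', LinearMap.coe_mk,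
    AddHom.coe_mk]
  rw [real_inner_smul_left, InnerProductSpace.toDual_symm_apply, h]

theorem koszul_add {X Y Y' W : Π x : M, TangentSpace I x} {x : M} (hX : MDiffAt (T% X) x)
    (hY : MDiffAt (T% Y) x) (hY' : MDiffAt (T% Y') x) (hW : MDiffAt (T% W) x) :
    koszul I X (Y + Y') W x = koszul I X Y W x + koszul I X Y' W x := by
  have e1 : (fun y ↦ inner ℝ ((Y + Y') y) (W y))
      = fun y ↦ inner ℝ (Y y) (W y) + inner ℝ (Y' y) (W y) := by
    ext y; simp [inner_add_left]
  have e2 : (fun y ↦ inner ℝ (X y) ((Y + Y') y))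
      = fun y ↦ inner ℝ (X y) (Y y) + inner ℝ (X y) (Y' y) := by
    ext y; simp [inner_add_right]
  simp only [koszul, e1, e2]
  rw [mvfderiv_fun_add (mdiffAt_inner I hY hW) (mdiffAt_inner I hY' hW),
    mvfderiv_fun_add (mdiffAt_inner I hX hY) (mdiffAt_inner I hX hY'),
    mlieBracket_add_left hY hY', mlieBracket_add_right hY hY']
  simp [inner_add_left, inner_add_right]
  ring

theorem koszul_smul {X Y W : Π x : M, TangentSpace I x} {g : M → ℝ} {x : M}
    (hg : MDiffAt g x) (hX : MDiffAt (T% X) x)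
    (hY : MDiffAt (T% Y) x) (hW : MDiffAt (T% W) x) :
    koszul I X (g • Y) W x = g x * koszul I X Y W x
      + 2 * mvfderiv I g x (X x) * inner ℝ (Y x) (W x) := by
  have e1 : (fun y ↦ inner ℝ ((g • Y) y) (W y)) = fun y ↦ g y * inner ℝ (Y y) (W y) := by
    ext y; simp [inner_smul_left]
  have e2 : (fun y ↦ inner ℝ (X y) ((g • Y) y)) = fun y ↦ g y * inner ℝ (X y) (Y y) := by
    ext y; simp [inner_smul_right]
  simp only [koszul, e1, e2]
  rw [mvfderiv_fun_mul hg (mdiffAt_inner I hY hW), mvfderiv_fun_mul hg (mdiffAt_inner I hX hY),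
    mlieBracket_smul_left hg hY, mlieBracket_smul_right hg hY]
  simp [inner_add_left, inner_smul_left, inner_smul_right, mvfderiv]
  rw [real_inner_comm (Y x) (X x)]
  ring

variable (M) in
/-- The Levi-Civita connection of the Riemannian manifold `M`; `leviCivita I M Y x v` is
`(∇_v Y)(x)`. It is torsion-free and metric by the two theorems that follow. -/
def leviCivita : CovariantDerivative I E (TangentSpace I : M → Type _) where
  toFun := leviCivitaFun I
  isCovariantDerivativeOnUniv :=
    { add := by
        intro Y Y' x hY hY' _
        refine ContinuousLinearMap.ext fun v ↦ ext_inner_right ℝ fun w ↦ ?_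
        have hv := FiberBundle.mdifferentiableAt_extend I E v
        have hw := FiberBundle.mdifferentiableAt_extend I E w
        have h1 := inner_leviCivitaFun I hv (mdifferentiableAt_add_section hY hY') hw
        have h2 := inner_leviCivitaFun I hv hY hw
        have h3 := inner_leviCivitaFun I hv hY' hw
        rw [koszul_add I hv hY hY' hw] at h1
        simp only [FiberBundle.extend_apply_self] at h1 h2 h3
        rw [add_apply, inner_add_left, h2, h3]
        refine h1.trans ?_
        ring
      leibniz := by
        intro Y g x hY hg _
        refine ContinuousLinearMap.ext fun v ↦ ext_inner_right ℝ fun w ↦ ?_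
        have hv := FiberBundle.mdifferentiableAt_extend I E v
        have hw := FiberBundle.mdifferentiableAt_extend I E w
        have h1 := inner_leviCivitaFun I hv (hg.smul_section hY) hw
        have h2 := inner_leviCivitaFun I hv hY hw
        rw [koszul_smul I hg hv hY hw] at h1
        simp only [FiberBundle.extend_apply_self] at h1 h2
        refine h1.trans ?_
        simp [inner_add_left, real_inner_smul_left, h2]
        ring }

theorem leviCivita_torsion {X Y : Π x : M, TangentSpace I x} {x : M}
    (hX : MDiffAt (T% X) x) (hY : MDiffAt (T% Y) x) :
    leviCivita I M Y x (X x) - leviCivita I M X x (Y x) = mlieBracket I X Y x := by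
  refine ext_inner_right ℝ fun w ↦ ?_
  have hw := FiberBundle.mdifferentiableAt_extend I E w
  have h1 := inner_leviCivitaFun I hX hY hw
  have h2 := inner_leviCivitaFun I hY hX hw
  simp only [koszul, FiberBundle.extend_apply_self] at h1 h2
  rw [inner_sub_left]
  change inner ℝ (leviCivitaFun I Y x (X x)) w - inner ℝ (leviCivitaFun I X x (Y x)) w = _
  rw [h1, h2, mlieBracket_swap (V := Y) (W := X)]
  simp only [real_inner_comm, Pi.neg_apply, inner_neg_left]
  ring

theorem leviCivita_metric {X Y W : Π x : M, TangentSpace I x} {x : M} (hX : MDiffAt (T% X) x)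
    (hY : MDiffAt (T% Y) x) (hW : MDiffAt (T% W) x) :
    mvfderiv I (fun y ↦ inner ℝ (Y y) (W y)) x (X x)
      = inner ℝ (leviCivita I M Y x (X x)) (W x) + inner ℝ (Y x) (leviCivita I M W x (X x)) := by
  have h1 := inner_leviCivitaFun I hX hY hW
  have h2 := inner_leviCivitaFun I hX hW hY
  rw [real_inner_comm (leviCivita I M W x (X x)) (Y x)]
  change _ = inner ℝ (leviCivitaFun I Y x (X x)) (W x) + inner ℝ (leviCivitaFun I W x (X x)) (Y x)
  rw [h1, h2]
  have e : (fun y ↦ inner ℝ (W y) (Y y)) = fun y ↦ inner ℝ (Y y) (W y) := by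
    ext y; exact real_inner_comm _ _
  simp only [koszul, e]
  rw [mlieBracket_swap (V := W) (W := Y)]
  simp only [Pi.neg_apply, inner_neg_left]
  ring

end LeviCivita

noncomputable section Ambient

open Classical in
/-- `1` if `k ≠ 0` and `0` if `k = 0`: the codimension of the space form of curvature `k` in its
flat model space. -/
def nu (k : ℝ) : ℕ := if k = 0 then 0 else 1

open Classical in
/-- The sign of the `j`-th coordinate: Lorentzian (`-1` on the coordinate `0`) if `k < 0`,
Euclidean otherwise. -/
def coordSign (k : ℝ) {N : ℕ} (j : Fin N) : ℝ := if k < 0 ∧ (j : ℕ) = 0 then -1 else 1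

/-- The (Euclidean or Lorentzian) inner product of the flat model space of curvature `k`. -/
def factorForm (k : ℝ) {N : ℕ} (x y : Fin N → ℝ) : ℝ := ∑ j, coordSign k j * x j * y j

/-- The space form `𝕆_k^n` of dimension `n` and curvature `k`: all of `ℝⁿ` if `k = 0`, the sphere
`⟨x, x⟩ = 1 / k` in `ℝⁿ⁺¹` if `k > 0`, and the sheet `x₀ > 0` of the hyperboloid `⟨x, x⟩ = 1 / k`
in the Lorentz space `𝕃ⁿ⁺¹` if `k < 0`. -/
def spaceForm (k : ℝ) (n : ℕ) : Set (Fin (n + nu k) → ℝ) :=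
  {x | (k ≠ 0 → factorForm k x x = 1 / k) ∧ (k < 0 → ∀ j : Fin (n + nu k), (j : ℕ) = 0 → 0 < x j)}

/-- The flat space `ℝ^N = ℝ^{N_1} × ⋯ × ℝ^{N_ℓ}`, `N_i = n_i + nu (k_i)`. Its norm serves only as a
source of topology and calculus; lengths are measured by `form`. -/
abbrev Ambient {ℓ : ℕ} (n : Fin ℓ → ℕ) (k : Fin ℓ → ℝ) : Type :=
  (i : Fin ℓ) → (Fin (n i + nu (k i)) → ℝ)

variable {ℓ : ℕ} {n : Fin ℓ → ℕ} {k : Fin ℓ → ℝ}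

/-- The (possibly indefinite) product inner product of `ℝ^N`. -/
def form (x y : Ambient n k) : ℝ := ∑ i, factorForm (k i) (x i) (y i)

variable (n k) in
/-- The product of space forms `Ô = 𝕆_{k_1}^{n_1} × ⋯ × 𝕆_{k_ℓ}^{n_ℓ}`, as a subset of `ℝ^N`. -/
def productSpace : Set (Ambient n k) := {x | ∀ i, x i ∈ spaceForm (k i) (n i)}

/-- The orthogonal projection `π_i (x_1, …, x_ℓ) = (0, …, 0, x_i, 0, …, 0)`. -/
def proj (i : Fin ℓ) : Ambient n k →ₗ[ℝ] Ambient n k :=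
  LinearMap.single ℝ (fun i ↦ Fin (n i + nu (k i)) → ℝ) i ∘ₗ LinearMap.proj i

/-- The tangent space `T_p Ô`: the velocities at `p` of the smooth curves in `Ô` through `p`
(they form a linear subspace, so that taking the span adds nothing). -/
def tangentO (p : Ambient n k) : Submodule ℝ (Ambient n k) :=
  Submodule.span ℝ {v | ∃ γ : ℝ → Ambient n k, ContDiffAt ℝ ∞ γ 0 ∧
    (∀ᶠ t in nhds 0, γ t ∈ productSpace n k) ∧ γ 0 = p ∧ deriv γ 0 = v}

open Classical in
/-- The orthogonal projection, with respect to `form`, onto a subspace `W`: the `w ∈ W` with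
`v - w ⊥ W`. It exists and is unique if `form` is nondegenerate on `W`. -/
def orthProj (W : Submodule ℝ (Ambient n k)) (v : Ambient n k) : W :=
  if h : ∃ w : W, ∀ u : W, form (v - w : Ambient n k) u = 0 then h.choose else 0

open Classical in
/-- The adjoint of `A : U → W` with respect to the pairings `bU`, `bW`: `adjoint bU bW A w` is the
`u` such that `bU u u' = bW w (A u')` for all `u'`. It exists and is unique if `bU` is an inner
product on a finite-dimensional space and `bW`, `A` are linear. -/
def adjoint {U W : Type*} [Zero U] (bU : U → U → ℝ) (bW : W → W → ℝ) (A : U → W) (w : W) : U :=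
  if h : ∃ u, ∀ u', bU u u' = bW w (A u') then h.choose else 0

/-- `(A ∧ B) C = ⟨B, C⟩ A - ⟨A, C⟩ B`. -/
def wedge {V : Type*} [AddCommGroup V] [Module ℝ V] (b : V → V → ℝ) (A B C : V) : V :=
  b B C • A - b A C • B

end Ambient

noncomputable section Immersion

variable {E : Type*} [NormedAddCommGroup E] [NormedSpace ℝ E] [FiniteDimensional ℝ E]
  {H : Type*} [TopologicalSpace H] (I : ModelWithCorners ℝ E H)
  {M : Type*} [TopologicalSpace M] [ChartedSpace H M] [IsManifold I ∞ M]
  [RiemannianBundle (fun x : M ↦ TangentSpace I x)]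
  {ℓ : ℕ} {n : Fin ℓ → ℕ} {k : Fin ℓ → ℝ}

/-- `f : M → Ô` is a smooth isometric immersion. A map into the embedded submanifold `Ô` of `ℝ^N` is
smooth iff it is smooth as a map into `ℝ^N`. -/
structure IsIsometricImmersion (f : M → Ambient n k) : Prop where
  contMDiff : ContMDiff I 𝓘(ℝ, Ambient n k) ∞ f
  mem : ∀ x, f x ∈ productSpace n k
  isometric : ∀ (x : M) (u v : TangentSpace I x),
    form (mvfderiv I f x u) (mvfderiv I f x v) = inner ℝ u v

variable (f : M → Ambient n k)

/-- `X ∈ Γ(TM)` is smooth. -/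
def SmoothField (X : Π x : M, TangentSpace I x) : Prop :=
  ContMDiff I I.tangent ∞ (fun x ↦ (⟨x, X x⟩ : TangentBundle I M))

/-- The normal space `T_x^⊥ M = {ξ ∈ T_{f(x)} Ô | ξ ⊥ f_* T_x M}` of `f` at `x`. -/
def normalSpace (x : M) : Submodule ℝ (Ambient n k) where
  carrier := {ξ | ξ ∈ tangentO (f x) ∧ ∀ u : TangentSpace I x, form ξ (mvfderiv I f x u) = 0}
  add_mem' := by
    rintro a b ⟨ha, ha'⟩ ⟨hb, hb'⟩
    refine ⟨add_mem ha hb, fun u ↦ ?_⟩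
    have : form (a + b) (mvfderiv I f x u)
        = form a (mvfderiv I f x u) + form b (mvfderiv I f x u) := by
      simp [form, factorForm, ← Finset.sum_add_distrib, mul_add, add_mul]
    rw [this, ha', hb', add_zero]
  zero_mem' := ⟨zero_mem _, fun u ↦ by simp [form, factorForm]⟩
  smul_mem' := by
    rintro c a ⟨ha, ha'⟩
    refine ⟨Submodule.smul_mem _ _ ha, fun u ↦ ?_⟩
    have : form (c • a) (mvfderiv I f x u) = c * form a (mvfderiv I f x u) := by
      simp only [form, factorForm, Finset.mul_sum, Pi.smul_apply, smul_eq_mul]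
      refine Finset.sum_congr rfl fun _ _ ↦ Finset.sum_congr rfl fun _ _ ↦ by ring
    rw [this, ha', mul_zero]

/-- The metric of the normal bundle. -/
def normalForm {x : M} (ξ η : normalSpace I f x) : ℝ := form (ξ : Ambient n k) (η : Ambient n k)

/-- The metric of `M`. -/
def tangentForm {x : M} (u v : TangentSpace I x) : ℝ := inner ℝ u v

/-- `ξ ∈ Γ(T^⊥ M)` is smooth. -/
def SmoothNormal (ξ : Π x : M, normalSpace I f x) : Prop :=
  ContMDiff I 𝓘(ℝ, Ambient n k) ∞ (fun x ↦ (ξ x : Ambient n k))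

/-! ### The tensors `L_i`, `K_i`, `R_i`, `S_i`, `T_i`

Vectors of `T_{f(x)} Ô` are regarded as vectors of `ℝ^N`. -/

/-- `L_i = π_i ∘ f_*`. -/
def tensorL (i : Fin ℓ) (x : M) (u : TangentSpace I x) : Ambient n k := proj i (mvfderiv I f x u)

/-- `K_i = π_i` restricted to `T^⊥ M`. -/
def tensorK (i : Fin ℓ) (x : M) (ξ : normalSpace I f x) : Ambient n k := proj i (ξ : Ambient n k)

/-- `R_i = L_i^t L_i : TM → TM`. -/
def tensorR (i : Fin ℓ) (x : M) (u : TangentSpace I x) : TangentSpace I x :=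
  adjoint (tangentForm I) form (tensorL I f i x) (tensorL I f i x u)

/-- `S_i = K_i^t L_i : TM → T^⊥ M`. -/
def tensorS (i : Fin ℓ) (x : M) (u : TangentSpace I x) : normalSpace I f x :=
  adjoint (normalForm I f) form (tensorK I f i x) (tensorL I f i x u)

/-- `S_i^t : T^⊥ M → TM`, the adjoint of `S_i`. -/
def tensorSt (i : Fin ℓ) (x : M) (ξ : normalSpace I f x) : TangentSpace I x :=
  adjoint (tangentForm I) (normalForm I f) (tensorS I f i x) ξ

/-- `T_i = K_i^t K_i : T^⊥ M → T^⊥ M`. -/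
def tensorT (i : Fin ℓ) (x : M) (ξ : normalSpace I f x) : normalSpace I f x :=
  adjoint (normalForm I f) form (tensorK I f i x) (tensorK I f i x ξ)

/-! ### Connections, second fundamental form, shape operators -/

/-- `∇̄_u ζ` at `x`, for the Levi-Civita connection `∇̄` of the submanifold `Ô` of the flat space
`ℝ^N`, a field `ζ` along `f` tangent to `Ô`, and `u ∈ T_x M`: the component tangent to `Ô` of the
derivative of `ζ`. -/
def nablaBar (ζ : M → Ambient n k) (x : M) (u : TangentSpace I x) : Ambient n k :=
  orthProj (tangentO (f x)) (mvfderiv I ζ x u)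

/-- The normal connection `∇^⊥_X ξ = (∇̄_X ξ)^⊥`. -/
def nablaPerp (X : Π x : M, TangentSpace I x) (ξ : Π x : M, normalSpace I f x) (x : M) :
    normalSpace I f x :=
  orthProj (normalSpace I f x) (nablaBar I f (fun y ↦ (ξ y : Ambient n k)) x (X x))

/-- The second fundamental form `α(u, v) = (∇̄_u f_* V)^⊥`, with `V` a smooth local extension
of `v`. -/
def alpha (x : M) (u v : TangentSpace I x) : normalSpace I f x :=
  orthProj (normalSpace I f x)
    (nablaBar I f (fun y ↦ mvfderiv I f y (FiberBundle.extend E v y)) x u)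

/-- The shape operator: `⟨A_η u, v⟩ = ⟨α(u, v), η⟩`. -/
def shape (x : M) (η : normalSpace I f x) (u : TangentSpace I x) : TangentSpace I x :=
  adjoint (tangentForm I) (normalForm I f) (fun v ↦ alpha I f x u v) η

variable [IsContMDiffRiemannianBundle I ∞ E (fun x : M ↦ TangentSpace I x)]

/-- `∇_X Y` for the Levi-Civita connection of `M`. -/
def nabla (X Y : Π x : M, TangentSpace I x) (x : M) : TangentSpace I x :=
  leviCivita I M Y x (X x)

/-- The curvature tensor `ℛ(X, Y)Z = ∇_X ∇_Y Z - ∇_Y ∇_X Z - ∇_{[X, Y]} Z` of `M`. -/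
def curvature (X Y Z : Π x : M, TangentSpace I x) (x : M) : TangentSpace I x :=
  nabla I X (nabla I Y Z) x - nabla I Y (nabla I X Z) x - nabla I (mlieBracket I X Y) Z x

/-- The curvature tensor `ℛ^⊥` of the normal bundle. -/
def curvaturePerp (X Y : Π x : M, TangentSpace I x) (ξ : Π x : M, normalSpace I f x) (x : M) :
    normalSpace I f x :=
  nablaPerp I f X (nablaPerp I f Y ξ) x - nablaPerp I f Y (nablaPerp I f X ξ) x
    - nablaPerp I f (mlieBracket I X Y) ξ x

/-- `(∇_X R_i) Y = ∇_X (R_i Y) - R_i (∇_X Y)`. -/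
def covR (i : Fin ℓ) (X Y : Π x : M, TangentSpace I x) (x : M) : TangentSpace I x :=
  nabla I X (fun y ↦ tensorR I f i y (Y y)) x - tensorR I f i x (nabla I X Y x)

/-- `(∇_X S_i) Y = ∇^⊥_X (S_i Y) - S_i (∇_X Y)`. -/
def covS (i : Fin ℓ) (X Y : Π x : M, TangentSpace I x) (x : M) : normalSpace I f x :=
  nablaPerp I f X (fun y ↦ tensorS I f i y (Y y)) x - tensorS I f i x (nabla I X Y x)

/-- `(∇_X S_i^t) ξ = ∇_X (S_i^t ξ) - S_i^t (∇^⊥_X ξ)`. -/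
def covSt (i : Fin ℓ) (X : Π x : M, TangentSpace I x) (ξ : Π x : M, normalSpace I f x) (x : M) :
    TangentSpace I x :=
  nabla I X (fun y ↦ tensorSt I f i y (ξ y)) x - tensorSt I f i x (nablaPerp I f X ξ x)

/-- `(∇_X T_i) ξ = ∇^⊥_X (T_i ξ) - T_i (∇^⊥_X ξ)`. -/
def covT (i : Fin ℓ) (X : Π x : M, TangentSpace I x) (ξ : Π x : M, normalSpace I f x) (x : M) :
    normalSpace I f x :=
  nablaPerp I f X (fun y ↦ tensorT I f i y (ξ y)) x - tensorT I f i x (nablaPerp I f X ξ x)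

/-- `(∇^⊥_X α)(Y, Z) = ∇^⊥_X (α(Y, Z)) - α(∇_X Y, Z) - α(Y, ∇_X Z)`. -/
def covAlpha (X Y Z : Π x : M, TangentSpace I x) (x : M) : normalSpace I f x :=
  nablaPerp I f X (fun y ↦ alpha I f y (Y y) (Z y)) x
    - alpha I f x (nabla I X Y x) (Z x) - alpha I f x (Y x) (nabla I X Z x)

/-- `(∇_Y A)(X, ξ) = ∇_Y (A_ξ X) - A_ξ (∇_Y X) - A_{∇^⊥_Y ξ} X`. -/
def covShape (Y X : Π x : M, TangentSpace I x) (ξ : Π x : M, normalSpace I f x) (x : M) :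
    TangentSpace I x :=
  nabla I Y (fun y ↦ shape I f y (ξ y) (X y)) x
    - shape I f x (ξ x) (nabla I Y X x) - shape I f x (nablaPerp I f Y ξ x) (X x)

end Immersion

end SpaceFormProduct

open SpaceFormProduct

set_option linter.unusedSectionVars false

namespace SpaceFormProduct

section Calculus

variable {E : Type*} [NormedAddCommGroup E] [NormedSpace ℝ E]
  {H : Type*} [TopologicalSpace H] {I : ModelWithCorners ℝ E H}
  {M : Type*} [TopologicalSpace M] [ChartedSpace H M]
  {F F' G : Type*} [NormedAddCommGroup F] [NormedSpace ℝ F]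
  [NormedAddCommGroup F'] [NormedSpace ℝ F'] [NormedAddCommGroup G] [NormedSpace ℝ G]

theorem hasMFDerivAt_mvfderiv {Φ : M → F} {x : M} (hΦ : MDiffAt Φ x) :
    HasMFDerivAt I 𝓘(ℝ, F) Φ x (mvfderiv I Φ x) := hΦ.hasMFDerivAt

theorem mvfderiv_eq_of_hasMFDerivAt {Φ : M → F} {x : M} {A : TangentSpace I x →L[ℝ] F}
    (h : HasMFDerivAt I 𝓘(ℝ, F) Φ x A) : mvfderiv I Φ x = A := h.mfderiv

theorem mvfderiv_comp_apply_of_hasFDerivAt {Φ : M → F} {g : F → G} {g' : F →L[ℝ] G} {x : M}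
    (hg : HasFDerivAt g g' (Φ x)) (hΦ : MDiffAt Φ x) (v : TangentSpace I x) :
    mvfderiv I (fun y ↦ g (Φ y)) x v = g' (mvfderiv I Φ x v) := by
  have h := (hg.hasMFDerivAt).comp x (hasMFDerivAt_mvfderiv hΦ)
  exact congrArg (fun A : TangentSpace I x →L[ℝ] G ↦ A v) (mvfderiv_eq_of_hasMFDerivAt h)

theorem mvfderiv_clm_comp_apply (A : F →L[ℝ] G) {Φ : M → F} {x : M} (hΦ : MDiffAt Φ x)
    (v : TangentSpace I x) :
    mvfderiv I (fun y ↦ A (Φ y)) x v = A (mvfderiv I Φ x v) :=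
  mvfderiv_comp_apply_of_hasFDerivAt A.hasFDerivAt hΦ v

theorem mvfderiv_bilinear_apply (B : F →L[ℝ] F' →L[ℝ] G) {Φ : M → F} {Ψ : M → F'} {x : M}
    (hΦ : MDiffAt Φ x) (hΨ : MDiffAt Ψ x) (v : TangentSpace I x) :
    mvfderiv I (fun y ↦ B (Φ y) (Ψ y)) x v
      = B (mvfderiv I Φ x v) (Ψ x) + B (Φ x) (mvfderiv I Ψ x v) := by
  have h : HasMFDerivAt I 𝓘(ℝ, F × F') (fun y ↦ (Φ y, Ψ y)) x
      ((mvfderiv I Φ x).prod (mvfderiv I Ψ x)) :=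
    ⟨(hasMFDerivAt_mvfderiv hΦ).1.prodMk (hasMFDerivAt_mvfderiv hΨ).1,
      (hasMFDerivAt_mvfderiv hΦ).2.prodMk (hasMFDerivAt_mvfderiv hΨ).2⟩
  have h2 := (B.isBoundedBilinearMap.hasFDerivAt (Φ x, Ψ x)).hasMFDerivAt.comp x h
  have h3 := congrArg (fun A : TangentSpace I x →L[ℝ] G ↦ A v) (mvfderiv_eq_of_hasMFDerivAt h2)
  refine h3.trans ?_
  exact add_comm _ _

variable [IsManifold I ∞ M]

theorem contMDiffAt_mvfderiv_apply {Φ : M → F} (hΦ : ContMDiff I 𝓘(ℝ, F) ∞ Φ)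
    {X : Π x : M, TangentSpace I x} {x : M} (hX : CMDiffAt ∞ (T% X) x) :
    ContMDiffAt I 𝓘(ℝ, F) ∞ (fun y ↦ mvfderiv I Φ y (X y)) x := by
  have h1 : ContMDiff I.tangent (𝓘(ℝ, F).tangent) ∞ (tangentMap I 𝓘(ℝ, F) Φ) :=
    hΦ.contMDiff_tangentMap (by simp)
  have h2 := h1.contMDiffAt.comp x hX
  exact ((contMDiff_snd_tangentBundle_modelSpace F 𝓘(ℝ, F)).contMDiffAt).comp x h2

end Calculus

section Commutator

variable {E : Type*} [NormedAddCommGroup E] [NormedSpace ℝ E]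
  {H : Type*} [TopologicalSpace H] {I : ModelWithCorners ℝ E H} [I.Boundaryless]
  {M : Type*} [TopologicalSpace M] [ChartedSpace H M] [IsManifold I ∞ M]
  {F : Type*} [NormedAddCommGroup F] [NormedSpace ℝ F]

/-- The derivative of a vector-valued function in the direction of a vector field, read in a chart. -/
theorem mvfderiv_apply_extChartAt_symm {Φ : M → F} (x : M) {y : E}
    (hy : y ∈ (extChartAt I x).target) (hΦ : MDiffAt Φ ((extChartAt I x).symm y))
    (X : Π x : M, TangentSpace I x) :
    mvfderiv I Φ ((extChartAt I x).symm y) (X ((extChartAt I x).symm y))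
      = fderiv ℝ (fun z ↦ Φ ((extChartAt I x).symm z)) y
          (mpullbackWithin 𝓘(ℝ, E) I (extChartAt I x).symm X (Set.range I) y) := by
  have hr : Set.range I = Set.univ := I.range_eq_univ
  have hs : HasMFDerivAt 𝓘(ℝ, E) I (extChartAt I x).symm y
      (mfderivWithin 𝓘(ℝ, E) I (extChartAt I x).symm (Set.range I) y) := by
    have := (mdifferentiableWithinAt_extChartAt_symm (I := I) hy).hasMFDerivWithinAt
    rw [hr, hasMFDerivWithinAt_univ] at this
    rwa [hr]
  have h1 := (hasMFDerivAt_mvfderiv hΦ).comp y hs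
  let A : E →L[ℝ] F := (mvfderiv I Φ ((extChartAt I x).symm y)).comp
    (mfderivWithin 𝓘(ℝ, E) I (extChartAt I x).symm (Set.range I) y)
  have h2 : fderiv ℝ (fun z ↦ Φ ((extChartAt I x).symm z)) y = A :=
    HasFDerivAt.fderiv (hasMFDerivAt_iff_hasFDerivAt.mp h1)
  have h3 := congrArg (fun A : E →L[ℝ] F ↦
    A (mpullbackWithin 𝓘(ℝ, E) I (extChartAt I x).symm X (Set.range I) y)) h2
  refine Eq.trans ?_ h3.symm
  have hinv := (isInvertible_mfderivWithin_extChartAt_symm (I := I) hy)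
  have h4 := hinv.self_apply_inverse (X ((extChartAt I x).symm y))
  exact (congrArg (mvfderiv I Φ ((extChartAt I x).symm y)) h4).symm

/-- Directional derivatives of a vector-valued function commute up to the Lie bracket. -/
theorem mvfderiv_mlieBracket [CompleteSpace E] {Φ : M → F} (hΦ : ContMDiff I 𝓘(ℝ, F) ∞ Φ)
    {X Y : Π x : M, TangentSpace I x} {x : M} (hX : CMDiffAt ∞ (T% X) x)
    (hY : CMDiffAt ∞ (T% Y) x) :
    mvfderiv I (fun y ↦ mvfderiv I Φ y (Y y)) x (X x)
      - mvfderiv I (fun y ↦ mvfderiv I Φ y (X y)) x (Y x)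
      = mvfderiv I Φ x (mlieBracket I X Y x) := by
  have hr : Set.range I = Set.univ := I.range_eq_univ
  have two_le_infty : (2 : ℕ∞ω) ≤ ∞ := WithTop.coe_le_coe.mpr le_top
  set φ := extChartAt I x with hφ
  set p := φ x with hp
  have hpt : p ∈ φ.target := mem_extChartAt_target x
  have hx : φ.symm p = x := extChartAt_to_inv x
  set g : E → F := fun z ↦ Φ (φ.symm z) with hg
  set pb : (Π x : M, TangentSpace I x) → E → E :=
    fun X ↦ mpullbackWithin 𝓘(ℝ, E) I φ.symm X (Set.range I) with hpb
  have key : ∀ (Ψ : M → F), MDiffAt Ψ x → ∀ X : Π x : M, TangentSpace I x,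
      mvfderiv I Ψ x (X x) = fderiv ℝ (fun z ↦ Ψ (φ.symm z)) p (pb X p) := by
    intro Ψ hΨ X
    have := mvfderiv_apply_extChartAt_symm (I := I) x hpt (Φ := Ψ)
      ((extChartAt_to_inv (I := I) x).symm ▸ hΨ) X
    rw [← hφ, hx] at this
    exact this
  have hd : ∀ {X : Π x : M, TangentSpace I x}, CMDiffAt ∞ (T% X) x →
      DifferentiableAt ℝ (pb X) p := by
    intro X hX
    have h1 : MDiffAt[Set.univ] (T% X) x :=
      (hX.mdifferentiableAt (by simp)).mdifferentiableWithinAt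
    have := h1.differentiableWithinAt_mpullbackWithin_vectorField
    simp only [Set.preimage_univ, hr, Set.univ_inter] at this
    simp only [hpb, hr]
    exact differentiableWithinAt_univ.mp this
  have hgs : ContDiffAt ℝ ∞ g p := by
    have h1 : ContMDiffAt 𝓘(ℝ, E) I ∞ φ.symm p := by
      have := contMDiffWithinAt_extChartAt_symm_range_self (I := I) (n := ∞) x
      rwa [hr, contMDiffWithinAt_univ] at this
    exact (hΦ.contMDiffAt.comp p h1).contDiffAt
  have hnear : ∀ X : Π x : M, TangentSpace I x,
      (fun z ↦ mvfderiv I Φ (φ.symm z) (X (φ.symm z)))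
        =ᶠ[nhds p] fun z ↦ fderiv ℝ g z (pb X z) := by
    intro X
    have : φ.target ∈ nhds p := extChartAt_target_mem_nhds x
    filter_upwards [this] with z hz
    exact mvfderiv_apply_extChartAt_symm (I := I) x hz
      (hΦ.contMDiffAt.mdifferentiableAt (by simp)) X
  have hg' : DifferentiableAt ℝ (fderiv ℝ g) p :=
    (hgs.fderiv_right (m := 1) (one_add_one_eq_two.trans_le two_le_infty)).differentiableAt (by simp)
  have hsym : IsSymmSndFDerivAt ℝ g p :=
    hgs.isSymmSndFDerivAt (by simpa using two_le_infty)
  have second : ∀ {X Y : Π x : M, TangentSpace I x}, CMDiffAt ∞ (T% Y) x →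
      mvfderiv I (fun y ↦ mvfderiv I Φ y (Y y)) x (X x)
        = fderiv ℝ (fderiv ℝ g) p (pb X p) (pb Y p) + fderiv ℝ g p (fderiv ℝ (pb Y) p (pb X p)) := by
    intro X Y hY
    rw [key _ ((contMDiffAt_mvfderiv_apply hΦ hY).mdifferentiableAt (by simp)) X,
      (hnear Y).fderiv_eq, fderiv_clm_apply hg' (hd hY)]
    simp [add_comm]
  have hΦφ : HasMFDerivAt I 𝓘(ℝ, F) Φ x ((fderiv ℝ g p).comp (mfderiv I 𝓘(ℝ, E) φ x)) := by
    have h1 : HasMFDerivAt I 𝓘(ℝ, E) φ x (mfderiv I 𝓘(ℝ, E) φ x) :=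
      (mdifferentiableAt_extChartAt (mem_chart_source H x)).hasMFDerivAt
    have h2 : HasMFDerivAt I 𝓘(ℝ, F) (g ∘ φ) x ((fderiv ℝ g p).comp (mfderiv I 𝓘(ℝ, E) φ x)) :=
      ((hgs.differentiableAt (by simp)).hasFDerivAt.hasMFDerivAt).comp x h1
    refine h2.congr_of_eventuallyEq ?_
    filter_upwards [extChartAt_source_mem_nhds (I := I) x] with y hy
    simp only [hg, Function.comp_apply, hφ, (extChartAt I x).left_inv hy]
  have hb : mfderiv I 𝓘(ℝ, E) φ x (mlieBracket I X Y x) = lieBracket ℝ (pb X) (pb Y) p := by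
    rw [← mlieBracketWithin_univ, mlieBracketWithin_apply]
    have hinv := isInvertible_mfderiv_extChartAt (I := I) (mem_extChartAt_source (I := I) x)
    refine (hinv.self_apply_inverse _).trans ?_
    simp only [Set.preimage_univ, hr, Set.univ_inter, hpb]
    exact congrFun lieBracketWithin_univ p
  have hΦb : mvfderiv I Φ x (mlieBracket I X Y x) = fderiv ℝ g p (lieBracket ℝ (pb X) (pb Y) p) := by
    rw [mvfderiv_eq_of_hasMFDerivAt hΦφ, ← hb]
    rfl
  rw [second hY, second hX, hΦb, lieBracket, map_sub, hsym.eq (pb X p) (pb Y p)]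
  abel

end Commutator

section FactorForm

theorem factorForm_add_left (k : ℝ) {N : ℕ} (x x' y : Fin N → ℝ) :
    factorForm k (x + x') y = factorForm k x y + factorForm k x' y := by
  simp [factorForm, mul_add, add_mul, Finset.sum_add_distrib]

theorem factorForm_smul_left (k : ℝ) {N : ℕ} (c : ℝ) (x y : Fin N → ℝ) :
    factorForm k (c • x) y = c * factorForm k x y := by
  simp only [factorForm, Finset.mul_sum, Pi.smul_apply, smul_eq_mul]
  exact Finset.sum_congr rfl fun _ _ ↦ by ring

theorem factorForm_comm (k : ℝ) {N : ℕ} (x y : Fin N → ℝ) :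
    factorForm k x y = factorForm k y x :=
  Finset.sum_congr rfl fun _ _ ↦ by ring

theorem factorForm_add_right (k : ℝ) {N : ℕ} (x y y' : Fin N → ℝ) :
    factorForm k x (y + y') = factorForm k x y + factorForm k x y' := by
  simp only [factorForm_comm k x, factorForm_add_left]

theorem factorForm_smul_right (k : ℝ) {N : ℕ} (c : ℝ) (x y : Fin N → ℝ) :
    factorForm k x (c • y) = c * factorForm k x y := by
  simp only [factorForm_comm k x, factorForm_smul_left]

theorem factorForm_self_of_nonneg {k : ℝ} (hk : 0 ≤ k) {N : ℕ} (x : Fin N → ℝ) :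
    factorForm k x x = ∑ j, x j ^ 2 := by
  simp only [factorForm, coordSign, not_lt.mpr hk, false_and, if_false]
  exact Finset.sum_congr rfl fun _ _ ↦ by ring

theorem factorForm_succ_of_neg {k : ℝ} (hk : k < 0) {N : ℕ} (x y : Fin (N + 1) → ℝ) :
    factorForm k x y = - (x 0 * y 0) + ∑ j : Fin N, x j.succ * y j.succ := by
  simp [factorForm, coordSign, hk, Fin.sum_univ_succ]

/-- The reverse Cauchy-Schwarz inequality: the orthogonal complement of a timelike vector is
spacelike. -/
theorem factorForm_pos_of_timelike {k : ℝ} (hk : k < 0) {N : ℕ} {p v : Fin (N + 1) → ℝ}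
    (hp : factorForm k p p < 0) (hv : factorForm k v p = 0) (hv0 : v ≠ 0) :
    0 < factorForm k v v := by
  rw [factorForm_succ_of_neg hk] at hp hv ⊢
  by_contra! hneg
  set a := ∑ j : Fin N, v j.succ * v j.succ with ha
  set b := ∑ j : Fin N, p j.succ * p j.succ with hb
  set c := ∑ j : Fin N, v j.succ * p j.succ with hc
  have hcs : c ^ 2 ≤ a * b := by
    have := Finset.sum_mul_sq_le_sq_mul_sq Finset.univ (fun j : Fin N ↦ v j.succ)
      (fun j ↦ p j.succ)
    simpa only [ha, hb, hc, sq] using this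
  have ha0 : 0 ≤ a := Finset.sum_nonneg fun j _ ↦ mul_self_nonneg _
  have hb0 : 0 ≤ b := Finset.sum_nonneg fun j _ ↦ mul_self_nonneg _
  have hc2 : c = v 0 * p 0 := by linarith
  have h1 : v 0 ^ 2 * (p 0 ^ 2 - b) ≤ 0 := by
    have : a * b ≤ v 0 ^ 2 * b := by nlinarith
    rw [hc2] at hcs
    nlinarith
  have hv00 : v 0 = 0 := by
    by_contra h
    have : 0 < v 0 ^ 2 * (p 0 ^ 2 - b) := mul_pos (by positivity) (by nlinarith)
    linarith
  have ha' : a = 0 := by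
    rw [hv00] at hneg
    linarith
  refine hv0 (funext fun j ↦ ?_)
  refine Fin.cases hv00 (fun j ↦ ?_) j
  have := (Finset.sum_eq_zero_iff_of_nonneg fun j _ ↦ mul_self_nonneg (v (Fin.succ j))).mp ha' j
    (Finset.mem_univ _)
  simpa using this

theorem factorForm_pos_of_mem_spaceForm {k : ℝ} {n : ℕ} {p v : Fin (n + nu k) → ℝ}
    (hp : p ∈ spaceForm k n) (hv : k * factorForm k v p = 0) (hv0 : v ≠ 0) :
    0 < factorForm k v v := by
  rcases lt_or_ge k 0 with hk | hk
  · have hpp := hp.1 hk.ne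
    have hpk : factorForm k p p < 0 := by rw [hpp]; exact one_div_neg.mpr hk
    have hvp : factorForm k v p = 0 := (mul_eq_zero.mp hv).resolve_left hk.ne
    have hN : n + nu k = n + 1 := by simp [nu, hk.ne]
    clear hp hpp hv
    revert p v
    rw [hN]
    intro p v hv0 hpk hvp
    exact factorForm_pos_of_timelike hk hpk hvp hv0
  · rw [factorForm_self_of_nonneg hk]
    obtain ⟨j, hj⟩ := Function.ne_iff.mp hv0
    rw [Pi.zero_apply] at hj
    exact Finset.sum_pos' (fun _ _ ↦ sq_nonneg _) ⟨j, Finset.mem_univ _, by positivity⟩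

end FactorForm

noncomputable section AmbientAlgebra

variable {ℓ : ℕ} {n : Fin ℓ → ℕ} {k : Fin ℓ → ℝ}

theorem form_add_left (x x' y : Ambient n k) : form (x + x') y = form x y + form x' y := by
  simp [form, factorForm_add_left, Finset.sum_add_distrib]

theorem form_smul_left (c : ℝ) (x y : Ambient n k) : form (c • x) y = c * form x y := by
  simp [form, factorForm_smul_left, Finset.mul_sum]

theorem form_comm (x y : Ambient n k) : form x y = form y x :=
  Finset.sum_congr rfl fun _ _ ↦ factorForm_comm _ _ _

variable (n k) in
/-- `form` as a continuous bilinear map. -/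
def formL : Ambient n k →L[ℝ] Ambient n k →L[ℝ] ℝ :=
  (LinearMap.mk₂ ℝ (form (n := n) (k := k)) form_add_left form_smul_left
    (fun x y y' ↦ by simp only [form_comm x, form_add_left])
    (fun c x y ↦ by simp only [form_comm x, form_smul_left, smul_eq_mul])).toContinuousBilinearMap

theorem formL_apply (x y : Ambient n k) : formL n k x y = form x y := rfl

theorem form_sub_left (x x' y : Ambient n k) : form (x - x') y = form x y - form x' y := by
  simp [← formL_apply]

theorem form_zero_left (y : Ambient n k) : form 0 y = 0 := by simp [← formL_apply]

theorem form_sum_left {ι : Type*} (s : Finset ι) (x : ι → Ambient n k) (y : Ambient n k) :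
    form (∑ i ∈ s, x i) y = ∑ i ∈ s, form (x i) y := by simp [← formL_apply]

theorem proj_apply_same (i : Fin ℓ) (x : Ambient n k) : proj i x i = x i := by simp [proj]

theorem proj_apply_of_ne {i j : Fin ℓ} (h : j ≠ i) (x : Ambient n k) : proj i x j = 0 := by
  simp [proj, h]

theorem form_proj_left (i : Fin ℓ) (x y : Ambient n k) :
    form (proj i x) y = factorForm (k i) (x i) (y i) := by
  rw [form, Finset.sum_eq_single i, proj_apply_same]
  · intro j _ hj
    simp [proj_apply_of_ne hj, factorForm]
  · simp

theorem form_proj_right (i : Fin ℓ) (x y : Ambient n k) : form x (proj i y) = form (proj i x) y := by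
  rw [form_comm, form_proj_left, form_proj_left, factorForm_comm]

theorem proj_proj (i : Fin ℓ) (x : Ambient n k) : proj i (proj i x) = proj i x := by
  ext j : 1
  rcases eq_or_ne j i with rfl | h
  · simp [proj_apply_same]
  · simp [proj_apply_of_ne h]

theorem proj_proj_of_ne {i j : Fin ℓ} (h : i ≠ j) (x : Ambient n k) : proj i (proj j x) = 0 := by
  ext j' : 1
  rcases eq_or_ne j' i with rfl | h'
  · simp [proj_apply_same, proj_apply_of_ne h]
  · simp [proj_apply_of_ne h']

/-- `π_i` as a continuous linear map. -/
def projL (i : Fin ℓ) : Ambient n k →L[ℝ] Ambient n k := (proj i).toContinuousLinearMap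

theorem projL_apply (i : Fin ℓ) (x : Ambient n k) : projL i x = proj i x := rfl

/-- The functional `v ↦ k_i ⟨π_i v, p⟩`. The common zeros of these functionals form the tangent
space of `Ô` at `p`. -/
def conormal (p : Ambient n k) (i : Fin ℓ) (v : Ambient n k) : ℝ := k i * form (proj i v) p

/-- The component of `v` normal to `Ô` at `p`. -/
def normalO (p : Ambient n k) (v : Ambient n k) : Ambient n k :=
  ∑ i, conormal p i v • proj i p

theorem conormal_add (p : Ambient n k) (i : Fin ℓ) (v w : Ambient n k) :
    conormal p i (v + w) = conormal p i v + conormal p i w := by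
  simp [conormal, form_add_left, mul_add]

theorem conormal_smul (p : Ambient n k) (i : Fin ℓ) (c : ℝ) (v : Ambient n k) :
    conormal p i (c • v) = c * conormal p i v := by
  simp only [conormal, map_smul, form_smul_left]
  ring

theorem proj_normalO (p : Ambient n k) (i : Fin ℓ) (v : Ambient n k) :
    proj i (normalO p v) = conormal p i v • proj i p := by
  rw [normalO, map_sum, Finset.sum_eq_single i, map_smul, proj_proj]
  · intro j _ hj
    rw [map_smul, proj_proj_of_ne hj.symm, smul_zero]
  · simp

theorem conormal_sub_normalO {p : Ambient n k} (hp : p ∈ productSpace n k) (i : Fin ℓ)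
    (v : Ambient n k) : conormal p i (v - normalO p v) = 0 := by
  have h : k i * (1 - k i * form (proj i p) p) = 0 := by
    rcases eq_or_ne (k i) 0 with h0 | h0
    · simp [h0]
    · rw [form_proj_left, (hp i).1 h0]
      field_simp
      ring
  rw [conormal, map_sub, proj_normalO, form_sub_left, form_smul_left, conormal]
  linear_combination form (proj i v) p * h

theorem form_normalO {p w : Ambient n k} (hw : ∀ i, conormal p i w = 0) (v : Ambient n k) :
    form (normalO p v) w = 0 := by
  rw [normalO, form_sum_left]
  refine Finset.sum_eq_zero fun i _ ↦ ?_
  have h : k i * form (proj i p) w = 0 := by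
    rw [← form_proj_right, form_comm]; exact hw i
  rw [form_smul_left, conormal]
  linear_combination form (proj i v) p * h

theorem form_self_pos {p v : Ambient n k} (hp : p ∈ productSpace n k)
    (hv : ∀ i, conormal p i v = 0) (hv0 : v ≠ 0) : 0 < form v v := by
  have hpos : ∀ i, v i ≠ 0 → 0 < factorForm (k i) (v i) (v i) := fun i hi ↦
    factorForm_pos_of_mem_spaceForm (hp i)
      (by have := hv i; rwa [conormal, form_proj_left] at this) hi
  obtain ⟨i, hi⟩ := Function.ne_iff.mp hv0
  refine Finset.sum_pos' (fun j _ ↦ ?_) ⟨i, Finset.mem_univ _, hpos i hi⟩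
  rcases eq_or_ne (v j) 0 with h | h
  · simp [h, factorForm]
  · exact (hpos j h).le

theorem conormal_deriv {p : Ambient n k} {γ : ℝ → Ambient n k} (hγ : DifferentiableAt ℝ γ 0)
    (hmem : ∀ᶠ t in nhds 0, γ t ∈ productSpace n k) (h0 : γ 0 = p) (i : Fin ℓ) :
    conormal p i (deriv γ 0) = 0 := by
  rcases eq_or_ne (k i) 0 with hk | hk
  · simp [conormal, hk]
  have h1 : HasDerivAt (fun t ↦ formL n k (projL i (γ t))) (formL n k (projL i (deriv γ 0))) 0 :=
    ((formL n k).comp (projL i)).hasFDerivAt.comp_hasDerivAt 0 hγ.hasDerivAt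
  have h2 := h1.clm_apply hγ.hasDerivAt
  have h3 : (fun t ↦ formL n k (projL i (γ t)) (γ t)) =ᶠ[nhds 0] fun _ ↦ 1 / k i := by
    filter_upwards [hmem] with t ht
    rw [formL_apply, projL_apply, form_proj_left]
    exact (ht i).1 hk
  have h4 := h2.unique ((hasDerivAt_const 0 (1 / k i)).congr_of_eventuallyEq h3)
  simp only [formL_apply, projL_apply, h0] at h4
  rw [form_comm (proj i p), form_proj_right] at h4
  rw [conormal]
  linear_combination k i / 2 * h4

/-- A curve in `Ô` with prescribed velocity. -/
theorem exists_curve {p v : Ambient n k} (hp : p ∈ productSpace n k)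
    (hv : ∀ i, conormal p i v = 0) :
    ∃ γ : ℝ → Ambient n k, ContDiffAt ℝ ∞ γ 0 ∧
      (∀ᶠ t in nhds 0, γ t ∈ productSpace n k) ∧ γ 0 = p ∧ deriv γ 0 = v := by
  let s : Fin ℓ → ℝ → ℝ := fun i t ↦ 1 + t ^ 2 * (k i * factorForm (k i) (v i) (v i))
  have hs0 : ∀ i, s i 0 = 1 := fun i ↦ by simp [s]
  have hs : ∀ i, ContDiff ℝ ∞ (s i) := fun i ↦ by fun_prop
  have hspos : ∀ᶠ t in nhds 0, ∀ i, 0 < s i t := by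
    refine Filter.eventually_all.mpr fun i ↦ ?_
    refine (hs i).continuous.continuousAt.eventually (lt_mem_nhds ?_)
    rw [hs0]; exact one_pos
  have hds : ∀ i, HasDerivAt (s i) 0 0 := fun i ↦ by
    have := ((hasDerivAt_pow 2 (0 : ℝ)).mul_const (k i * factorForm (k i) (v i) (v i))).const_add 1
    simpa [s] using this
  let r : Fin ℓ → ℝ → ℝ := fun i t ↦ (Real.sqrt (s i t))⁻¹
  have hr0 : ∀ i, r i 0 = 1 := fun i ↦ by simp [r, hs0]
  have hdr : ∀ i, HasDerivAt (r i) 0 0 := fun i ↦ by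
    have := ((hds i).sqrt (by simp [hs0])).inv (by simp [hs0])
    simp only [hs0, zero_div, neg_zero] at this
    exact this
  have hr : ∀ i, ContDiffAt ℝ ∞ (r i) 0 := fun i ↦
    ((hs i).contDiffAt.sqrt (by simp [hs0])).inv (by simp [hs0])
  have hγ : HasDerivAt (fun t i ↦ r i t • (p i + t • v i) : ℝ → Ambient n k) v 0 := by
    refine hasDerivAt_pi.mpr fun i ↦ ?_
    have := (hdr i).smul (((hasDerivAt_id (0 : ℝ)).smul_const (v i)).const_add (p i))
    simp only [hr0, one_smul, zero_smul, add_zero] at this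
    exact this
  refine ⟨fun t i ↦ r i t • (p i + t • v i), ?_, ?_, ?_, hγ.deriv⟩
  · refine contDiffAt_pi.mpr fun i ↦ (hr i).smul ?_
    fun_prop
  · have hpos : ∀ᶠ t in nhds (0 : ℝ), ∀ i, k i < 0 → ∀ j : Fin (n i + nu (k i)), (j : ℕ) = 0 →
        0 < (p i + t • v i) j := by
      refine Filter.eventually_all.mpr fun i ↦ ?_
      rw [Filter.eventually_imp_distrib_left]
      intro hk
      refine Filter.eventually_all.mpr fun j ↦ ?_
      rw [Filter.eventually_imp_distrib_left]
      intro hj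
      have hc : Continuous fun t : ℝ ↦ (p i + t • v i) j := by
        simp only [Pi.add_apply, Pi.smul_apply]; fun_prop
      refine hc.continuousAt.eventually (lt_mem_nhds ?_)
      simpa using (hp i).2 hk j hj
    filter_upwards [hspos, hpos] with t ht ht' i
    have hrpos : 0 < r i t := inv_pos.mpr (Real.sqrt_pos.mpr (ht i))
    refine ⟨fun hk ↦ ?_, fun hk j hj ↦ ?_⟩
    · have hvp : factorForm (k i) (v i) (p i) = 0 := by
        have := hv i
        rw [conormal, form_proj_left] at this
        exact (mul_eq_zero.mp this).resolve_left hk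
      simp only [factorForm_smul_left, factorForm_smul_right, factorForm_add_left,
        factorForm_add_right, hvp, factorForm_comm (k i) (p i) (v i), (hp i).1 hk]
      have hr2 : r i t * r i t = (s i t)⁻¹ := by
        simp only [r]
        rw [← mul_inv, Real.mul_self_sqrt (ht i).le]
      have hst : (s i t)⁻¹ * (1 / k i + t ^ 2 * factorForm (k i) (v i) (v i)) = 1 / k i := by
        rw [inv_mul_eq_iff_eq_mul₀ (ht i).ne']
        simp only [s]
        field_simp
      linear_combination (1 / k i + t ^ 2 * factorForm (k i) (v i) (v i)) * hr2 + hst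
    · simpa using mul_pos hrpos (ht' i hk j hj)
  · ext i : 1
    simp [hr0]

theorem mem_tangentO_iff {p : Ambient n k} (hp : p ∈ productSpace n k) (v : Ambient n k) :
    v ∈ tangentO p ↔ ∀ i, conormal p i v = 0 := by
  refine ⟨fun hv ↦ ?_, fun hv ↦ Submodule.subset_span (exists_curve hp hv)⟩
  induction hv using Submodule.span_induction with
  | mem v hv =>
    obtain ⟨γ, h1, h2, h3, rfl⟩ := hv
    exact conormal_deriv (h1.differentiableAt (by simp)) h2 h3
  | zero => intro i; simp [conormal, form_zero_left]
  | add v w _ _ hv hw => intro i; rw [conormal_add, hv, hw, add_zero]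
  | smul c v _ hv => intro i; rw [conormal_smul, hv, mul_zero]

theorem form_self_pos_of_mem_tangentO {p v : Ambient n k} (hp : p ∈ productSpace n k)
    (hv : v ∈ tangentO p) (hv0 : v ≠ 0) : 0 < form v v :=
  form_self_pos hp ((mem_tangentO_iff hp v).mp hv) hv0

theorem eq_of_form_eq {p : Ambient n k} (hp : p ∈ productSpace n k)
    {W : Submodule ℝ (Ambient n k)} (hW : W ≤ tangentO p) {w w' : W}
    (h : ∀ u : W, form (w : Ambient n k) u = form (w' : Ambient n k) u) : w = w' := by
  by_contra hne
  have h1 := form_self_pos_of_mem_tangentO hp (hW (w - w').2)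
    (fun h0 ↦ hne (sub_eq_zero.mp (Subtype.ext h0)))
  have h2 := h (w - w')
  rw [← sub_eq_zero, ← form_sub_left] at h2
  exact h1.ne' h2

theorem orthProj_eq {p : Ambient n k} (hp : p ∈ productSpace n k)
    {W : Submodule ℝ (Ambient n k)} (hW : W ≤ tangentO p) {v : Ambient n k} {w : W}
    (h : ∀ u : W, form (w : Ambient n k) u = form v u) : orthProj W v = w := by
  have hex : ∃ w : W, ∀ u : W, form (v - w : Ambient n k) u = 0 :=
    ⟨w, fun u ↦ by rw [form_sub_left, h, sub_self]⟩
  rw [orthProj, dif_pos hex]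
  refine eq_of_form_eq hp hW fun u ↦ ?_
  rw [h, ← sub_eq_zero, ← neg_sub, neg_eq_zero, ← form_sub_left]
  exact hex.choose_spec u

theorem adjoint_eq {U W : Type*} [Zero U] {bU : U → U → ℝ} {bW : W → W → ℝ} {A : U → W}
    (hU : ∀ u u', (∀ z, bU u z = bU u' z) → u = u') {w : W} {u : U}
    (h : ∀ u', bU u u' = bW w (A u')) : adjoint bU bW A w = u := by
  have hex : ∃ u, ∀ u', bU u u' = bW w (A u') := ⟨u, h⟩
  rw [adjoint, dif_pos hex]
  exact hU _ _ fun z ↦ (hex.choose_spec z).trans (h z).symm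

theorem coe_orthProj_tangentO {p : Ambient n k} (hp : p ∈ productSpace n k) (v : Ambient n k) :
    (orthProj (tangentO p) v : Ambient n k) = v - normalO p v := by
  have hmem : v - normalO p v ∈ tangentO p :=
    (mem_tangentO_iff hp _).mpr (conormal_sub_normalO hp · v)
  rw [orthProj_eq hp le_rfl (w := ⟨_, hmem⟩)]
  intro u
  rw [form_sub_left, form_normalO ((mem_tangentO_iff hp _).mp u.2), sub_zero]

end AmbientAlgebra

section MusicalSmoothness

variable {E : Type*} [NormedAddCommGroup E] [NormedSpace ℝ E] [FiniteDimensional ℝ E]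
  {H : Type*} [TopologicalSpace H] {I : ModelWithCorners ℝ E H}
  {M : Type*} [TopologicalSpace M] [ChartedSpace H M] [IsManifold I ∞ M]
  [RiemannianBundle (fun x : M ↦ TangentSpace I x)]
  [IsContMDiffRiemannianBundle I ∞ E (fun x : M ↦ TangentSpace I x)]

/-- A vector field is smooth if its inner products with all smooth fields are. -/
theorem contMDiffAt_of_inner {Y : Π x : M, TangentSpace I x} {x : M}
    (h : ∀ s : Π x : M, TangentSpace I x, CMDiffAt ∞ (T% s) x →
      ContMDiffAt I 𝓘(ℝ, ℝ) ∞ (fun y ↦ inner ℝ (Y y) (s y)) x) :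
    CMDiffAt ∞ (T% Y) x := by
  have : IsManifold I 1 M := IsManifold.of_le (n := ∞) (by exact_mod_cast le_top)
  let t := trivializationAt E (TangentSpace I : M → Type _) x
  have hxt : x ∈ t.baseSet := FiberBundle.mem_baseSet_trivializationAt E (TangentSpace I) x
  let b := Module.finBasis ℝ E
  let ι := Fin (Module.finrank ℝ E)
  let s : ι → Π x : M, TangentSpace I x := fun j ↦ t.localFrame b j
  have hs : ∀ j, CMDiffAt ∞ (T% (s j)) x := fun j ↦ contMDiffAt_localFrame_of_mem ∞ t b j hxt
  let gram : M → ι → ι → ℝ := fun y l j ↦ inner ℝ (s j y) (s l y)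
  let T : (ι → ι → ℝ) →ₗ[ℝ] ((ι → ℝ) →L[ℝ] (ι → ℝ)) :=
    { toFun := fun g ↦ LinearMap.toContinuousLinearMap (Matrix.toLin' (Matrix.of g))
      map_add' := fun g g' ↦ by rw [← Matrix.of_add_of, map_add, map_add]
      map_smul' := fun c g ↦ by rw [← Matrix.smul_of, map_smul, map_smul]; rfl }
  let G : M → ((ι → ℝ) →L[ℝ] (ι → ℝ)) := fun y ↦ T (gram y)
  have hGapp : ∀ y c l, G y c l = inner ℝ (∑ j, c j • s j y) (s l y) := by
    intro y c l
    simp only [sum_inner, real_inner_smul_left]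
    have h1 : G y c l = ∑ j, gram y l j * c j := by
      change Matrix.toLin' (Matrix.of (gram y)) c l = _
      rw [Matrix.toLin'_apply]
      rfl
    exact h1.trans <| Finset.sum_congr rfl fun j _ ↦ mul_comm (inner ℝ (s j y) (s l y)) (c j)
  have hgram : ContMDiffAt I 𝓘(ℝ, ι → ι → ℝ) ∞ gram x := by
    refine contMDiffAt_pi_space.mpr fun l ↦ contMDiffAt_pi_space.mpr fun j ↦ ?_
    exact ContMDiffAt.inner_bundle (E := (TangentSpace I : M → Type _)) (hs j) (hs l)
  have hG : ContMDiffAt I 𝓘(ℝ, (ι → ℝ) →L[ℝ] (ι → ℝ)) ∞ G x :=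
    T.toContinuousLinearMap.contMDiff.contMDiffAt.comp x hgram
  have hinj : ∀ y ∈ t.baseSet, Function.Injective (G y) := by
    intro y hy
    refine (injective_iff_map_eq_zero (G y)).mpr fun c hc ↦ ?_
    have h0 : ∑ j, c j • s j y = 0 := by
      rw [← inner_self_eq_zero (𝕜 := ℝ), inner_sum]
      refine Finset.sum_eq_zero fun l _ ↦ ?_
      rw [real_inner_smul_right, ← hGapp, hc, Pi.zero_apply, mul_zero]
    have hli := (t.isLocalFrameOn_localFrame_baseSet I ∞ b).linearIndependent hy
    exact funext (Fintype.linearIndependent_iff.mp hli c h0)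
  have hinv : ∀ y ∈ t.baseSet, (G y).IsInvertible := fun y hy ↦
    ⟨(LinearEquiv.ofInjectiveEndo (G y : (ι → ℝ) →ₗ[ℝ] (ι → ℝ)) (hinj y hy)).toContinuousLinearEquiv,
      by ext; rfl⟩
  let β : M → ι → ℝ := fun y l ↦ inner ℝ (Y y) (s l y)
  have hβ : ContMDiffAt I 𝓘(ℝ, ι → ℝ) ∞ β x := contMDiffAt_pi_space.mpr fun l ↦ h (s l) (hs l)
  have hsol : ContMDiffAt I 𝓘(ℝ, ι → ℝ) ∞ (fun y ↦ (G y).inverse (β y)) x := by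
    have h1 : ContMDiffAt I 𝓘(ℝ, (ι → ℝ) →L[ℝ] (ι → ℝ)) ∞ (fun y ↦ (G y).inverse) x :=
      (hinv x hxt).contDiffAt_map_inverse.contMDiffAt.comp x hG
    exact h1.clm_apply hβ
  rw [contMDiffAt_iff_localFrameCoeff b hxt]
  intro j
  refine (contMDiffAt_pi_space.mp hsol j).congr_of_eventuallyEq ?_
  filter_upwards [t.open_baseSet.mem_nhds hxt] with y hy
  have h1 : G y (fun j ↦ t.localFrameCoeff I b j y (Y y)) = β y := by
    ext l
    rw [hGapp]
    exact congrArg (fun z ↦ inner ℝ z (s l y)) (t.eq_sum_localFrameCoeff_smul hy).symm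
  have h2 := (hinv y hy).inverse_apply_eq.mpr h1.symm
  exact (congrFun h2 j).symm

end MusicalSmoothness

noncomputable section Splitting

variable {E : Type*} [NormedAddCommGroup E] [NormedSpace ℝ E] [FiniteDimensional ℝ E]
  {H : Type*} [TopologicalSpace H] {I : ModelWithCorners ℝ E H}
  {M : Type*} [TopologicalSpace M] [ChartedSpace H M] [IsManifold I ∞ M]
  [RiemannianBundle (fun x : M ↦ TangentSpace I x)]
  {ℓ : ℕ} {n : Fin ℓ → ℕ} {k : Fin ℓ → ℝ} {f : M → Ambient n k}

variable (I f) in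
/-- The adjoint of `f_*` at `x`, with respect to `form`. -/
def tangentPart (x : M) : Ambient n k →ₗ[ℝ] TangentSpace I x :=
  have : FiniteDimensional ℝ (TangentSpace I x) := inferInstanceAs (FiniteDimensional ℝ E)
  have : CompleteSpace (TangentSpace I x) := FiniteDimensional.complete ℝ _
  { toFun := fun v ↦ (InnerProductSpace.toDual ℝ (TangentSpace I x)).symm
      ((formL n k v).comp (mvfderiv I f x))
    map_add' := fun v w ↦ by simp [ContinuousLinearMap.add_comp]
    map_smul' := fun c v ↦ by simp [ContinuousLinearMap.smul_comp] }

theorem inner_tangentPart (x : M) (v : Ambient n k) (u : TangentSpace I x) :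
    inner ℝ (tangentPart I f x v) u = form v (mvfderiv I f x u) := by
  have : FiniteDimensional ℝ (TangentSpace I x) := inferInstanceAs (FiniteDimensional ℝ E)
  have : CompleteSpace (TangentSpace I x) := FiniteDimensional.complete ℝ _
  exact InnerProductSpace.toDual_symm_apply

theorem tangentPart_eq {x : M} {v : Ambient n k} {w : TangentSpace I x}
    (h : ∀ u, inner ℝ w u = form v (mvfderiv I f x u)) : tangentPart I f x v = w :=
  ext_inner_right ℝ fun u ↦ by rw [inner_tangentPart, h]

theorem IsIsometricImmersion.mdifferentiableAt (hf : IsIsometricImmersion I f) (x : M) :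
    MDifferentiableAt I 𝓘(ℝ, Ambient n k) f x :=
  hf.contMDiff.contMDiffAt.mdifferentiableAt (by simp)

/-- The derivative of a field tangent to `Ô`: the component normal to `Ô`. -/
theorem conormal_mvfderiv (hf : IsIsometricImmersion I f) {Φ : M → Ambient n k} {x : M}
    (hΦ : MDifferentiableAt I 𝓘(ℝ, Ambient n k) Φ x) {i : Fin ℓ} {c : ℝ}
    (ht : ∀ y, conormal (f y) i (Φ y) = c) (u : TangentSpace I x) :
    conormal (f x) i (mvfderiv I Φ x u) = - (k i * form (Φ x) (proj i (mvfderiv I f x u))) := by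
  have h1 := mvfderiv_bilinear_apply ((k i) • (formL n k).comp (projL i)) hΦ
    (hf.mdifferentiableAt x) u
  have h2 : (fun y ↦ ((k i) • (formL n k).comp (projL i)) (Φ y) (f y)) = fun _ ↦ c := funext ht
  rw [h2, mvfderiv_const] at h1
  simp only [zero_apply, smul_apply, ContinuousLinearMap.comp_apply,
    formL_apply, projL_apply, smul_eq_mul] at h1
  rw [form_proj_right, conormal]
  linarith

theorem conormal_mvfderiv_self (hf : IsIsometricImmersion I f) (x : M) (i : Fin ℓ)
    (u : TangentSpace I x) : conormal (f x) i (mvfderiv I f x u) = 0 := by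
  have h : ∀ y, conormal (f y) i (f y) = k i * (1 / k i) := fun y ↦ by
    rcases eq_or_ne (k i) 0 with h0 | h0
    · simp [conormal, h0]
    · rw [conormal, form_proj_left, (hf.mem y i).1 h0]
  have h1 := conormal_mvfderiv hf (hf.mdifferentiableAt x) h u
  have h2 : form (f x) (proj i (mvfderiv I f x u)) = form (proj i (mvfderiv I f x u)) (f x) :=
    form_comm _ _
  rw [h2] at h1
  rw [conormal] at h1 ⊢
  linarith

theorem tangentPart_proj_base (hf : IsIsometricImmersion I f) (x : M) (i : Fin ℓ) :
    k i • tangentPart I f x (proj i (f x)) = 0 := by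
  rw [← map_smul]
  refine tangentPart_eq fun u ↦ ?_
  have := conormal_mvfderiv_self hf x i u
  rw [inner_zero_left, form_smul_left, ← form_proj_right, form_comm]
  exact this.symm

theorem conormal_eq_zero_of_mem (hf : IsIsometricImmersion I f) {x : M} (ξ : normalSpace I f x)
    (i : Fin ℓ) : conormal (f x) i ξ = 0 :=
  (mem_tangentO_iff (hf.mem x) _).mp ξ.2.1 i

variable (I f) in
theorem normalSpace_le_tangentO (x : M) : normalSpace I f x ≤ tangentO (f x) := fun _ h ↦ h.1

theorem conormal_sub (p : Ambient n k) (i : Fin ℓ) (v w : Ambient n k) :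
    conormal p i (v - w) = conormal p i v - conormal p i w := by
  simp [conormal, form_sub_left, mul_sub]

theorem normalO_add (p v w : Ambient n k) : normalO p (v + w) = normalO p v + normalO p w := by
  simp [normalO, conormal_add, add_smul, Finset.sum_add_distrib]

theorem normalO_smul (p : Ambient n k) (c : ℝ) (v : Ambient n k) :
    normalO p (c • v) = c • normalO p v := by
  simp [normalO, conormal_smul, mul_smul, Finset.smul_sum]

/-- The orthogonal projection onto the normal space of `f` at `x`. -/
def normalPart (hf : IsIsometricImmersion I f) (x : M) : Ambient n k →ₗ[ℝ] normalSpace I f x where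
  toFun v := ⟨v - normalO (f x) v - mvfderiv I f x (tangentPart I f x v), by
    refine ⟨?_, fun u ↦ ?_⟩
    · rw [mem_tangentO_iff (hf.mem x)]
      intro i
      rw [conormal_sub, conormal_sub_normalO (hf.mem x), conormal_mvfderiv_self hf, sub_zero]
    · rw [form_sub_left, form_sub_left, hf.isometric, inner_tangentPart,
        form_normalO (conormal_mvfderiv_self hf x · u)]
      ring⟩
  map_add' v w := Subtype.ext (by simp only [normalO_add, map_add, Submodule.coe_add]; abel)
  map_smul' c v := Subtype.ext (by
    simp only [normalO_smul, map_smul, SetLike.val_smul, smul_sub, RingHom.id_apply])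

theorem coe_normalPart (hf : IsIsometricImmersion I f) (x : M) (v : Ambient n k) :
    (normalPart hf x v : Ambient n k)
      = v - normalO (f x) v - mvfderiv I f x (tangentPart I f x v) := rfl

/-- The decomposition of a vector of `ℝ^N` into its components tangent to `M`, normal to `M` in `Ô`
and normal to `Ô`. -/
theorem splitting (hf : IsIsometricImmersion I f) (x : M) (v : Ambient n k) :
    v = mvfderiv I f x (tangentPart I f x v) + normalPart hf x v + normalO (f x) v := by
  rw [coe_normalPart]
  abel

theorem form_normalPart (hf : IsIsometricImmersion I f) {x : M} (v : Ambient n k)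
    (η : normalSpace I f x) : form (normalPart hf x v : Ambient n k) η = form v η := by
  rw [coe_normalPart, form_sub_left, form_sub_left, form_comm (mvfderiv I f x _), η.2.2,
    form_normalO (conormal_eq_zero_of_mem hf η)]
  ring

theorem normalForm_ext (hf : IsIsometricImmersion I f) {x : M} {η η' : normalSpace I f x}
    (h : ∀ z, normalForm I f η z = normalForm I f η' z) : η = η' :=
  eq_of_form_eq (hf.mem x) (normalSpace_le_tangentO I f x) h

theorem normalPart_eq (hf : IsIsometricImmersion I f) {x : M} {v : Ambient n k}
    {η : normalSpace I f x} (h : ∀ z : normalSpace I f x, form (η : Ambient n k) z = form v z) :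
    normalPart hf x v = η :=
  normalForm_ext hf fun z ↦ (form_normalPart hf v z).trans (h z).symm

theorem normalPart_mvfderiv (hf : IsIsometricImmersion I f) (x : M) (u : TangentSpace I x) :
    normalPart hf x (mvfderiv I f x u) = 0 :=
  normalPart_eq hf fun z ↦ by rw [form_comm (mvfderiv I f x u), z.2.2]; exact form_zero_left _

theorem normalPart_proj_base (hf : IsIsometricImmersion I f) (x : M) (i : Fin ℓ) :
    k i • normalPart hf x (proj i (f x)) = 0 := by
  rw [← map_smul]
  refine normalPart_eq hf fun z ↦ ?_
  have := conormal_eq_zero_of_mem hf z i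
  rw [form_smul_left, ← form_proj_right, form_comm (f x)]
  exact (form_zero_left _).trans this.symm

theorem orthProj_normalSpace (hf : IsIsometricImmersion I f) (x : M) (v : Ambient n k) :
    orthProj (normalSpace I f x) (orthProj (tangentO (f x)) v : Ambient n k)
      = normalPart hf x v := by
  refine orthProj_eq (hf.mem x) (normalSpace_le_tangentO I f x) fun z ↦ ?_
  rw [form_normalPart, coe_orthProj_tangentO (hf.mem x), form_sub_left,
    form_normalO (conormal_eq_zero_of_mem hf z), sub_zero]

/-! ### The tensors in terms of the splitting -/

theorem tangentForm_ext {x : M} {u u' : TangentSpace I x}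
    (h : ∀ z, tangentForm I u z = tangentForm I u' z) : u = u' := ext_inner_right ℝ h

theorem form_proj_proj (i : Fin ℓ) (v w : Ambient n k) :
    form (proj i v) (proj i w) = form (proj i v) w := by
  rw [form_proj_right, proj_proj]

theorem tensorR_eq (i : Fin ℓ) (x : M) (u : TangentSpace I x) :
    tensorR I f i x u = tangentPart I f x (proj i (mvfderiv I f x u)) :=
  adjoint_eq (fun _ _ ↦ tangentForm_ext) fun u' ↦ by
    rw [tangentForm, inner_tangentPart, tensorL, tensorL, form_proj_proj]

theorem tensorS_eq (hf : IsIsometricImmersion I f) (i : Fin ℓ) (x : M) (u : TangentSpace I x) :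
    tensorS I f i x u = normalPart hf x (proj i (mvfderiv I f x u)) :=
  adjoint_eq (fun _ _ ↦ normalForm_ext hf) fun z ↦ by
    rw [normalForm, form_normalPart, tensorL, tensorK, form_proj_proj]

theorem tensorT_eq (hf : IsIsometricImmersion I f) (i : Fin ℓ) (x : M) (ξ : normalSpace I f x) :
    tensorT I f i x ξ = normalPart hf x (proj i (ξ : Ambient n k)) :=
  adjoint_eq (fun _ _ ↦ normalForm_ext hf) fun z ↦ by
    rw [normalForm, form_normalPart, tensorK, tensorK, form_proj_proj]

theorem tensorSt_eq (hf : IsIsometricImmersion I f) (i : Fin ℓ) (x : M) (ξ : normalSpace I f x) :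
    tensorSt I f i x ξ = tangentPart I f x (proj i (ξ : Ambient n k)) :=
  adjoint_eq (fun _ _ ↦ tangentForm_ext) fun u ↦ by
    rw [tangentForm, inner_tangentPart, normalForm, tensorS_eq hf, form_comm (ξ : Ambient n k),
      form_normalPart, form_comm (proj i (mvfderiv I f x u)), form_proj_right]

theorem nablaPerp_eq (hf : IsIsometricImmersion I f) (X : Π x : M, TangentSpace I x)
    (ξ : Π x : M, normalSpace I f x) (x : M) :
    nablaPerp I f X ξ x
      = normalPart hf x (mvfderiv I (fun y ↦ (ξ y : Ambient n k)) x (X x)) :=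
  orthProj_normalSpace hf x _

theorem mdifferentiableAt_mvfderiv_apply (hf : IsIsometricImmersion I f)
    {Y : Π x : M, TangentSpace I x} {x : M} (hY : MDiffAt (T% Y) x) :
    MDifferentiableAt I 𝓘(ℝ, Ambient n k) (fun y ↦ mvfderiv I f y (Y y)) x := by
  have h1 : ContMDiff I.tangent (𝓘(ℝ, Ambient n k).tangent) ∞ (tangentMap I 𝓘(ℝ, Ambient n k) f) :=
    hf.contMDiff.contMDiff_tangentMap (by simp)
  have h2 := (h1.contMDiffAt.mdifferentiableAt (by simp)).comp x hY
  exact ((contMDiff_snd_tangentBundle_modelSpace (n := ∞) (Ambient n k)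
    𝓘(ℝ, Ambient n k)).contMDiffAt.mdifferentiableAt (by simp)).comp x h2

/-- The second fundamental form does not depend on the extension of its second argument. -/
theorem alpha_eq (hf : IsIsometricImmersion I f) {Y : Π x : M, TangentSpace I x} {x : M}
    (hY : MDiffAt (T% Y) x) (u : TangentSpace I x) :
    alpha I f x u (Y x) = normalPart hf x (mvfderiv I (fun y ↦ mvfderiv I f y (Y y)) x u) := by
  have : IsManifold I 1 M := IsManifold.of_le (n := ∞) (by exact_mod_cast le_top)
  have ht : TensorialAt I E (fun σ : Π x : M, TangentSpace I x ↦
      normalPart hf x (mvfderiv I (fun y ↦ mvfderiv I f y (σ y)) x u)) x :=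
    { smul := fun {g σ} hg hσ ↦ by
        have e : (fun y ↦ mvfderiv I f y ((g • σ) y)) = fun y ↦ g y • mvfderiv I f y (σ y) := by
          ext1 y; exact map_smul _ _ _
        rw [e, mvfderiv_fun_smul hg (mdifferentiableAt_mvfderiv_apply hf hσ)]
        simp [normalPart_mvfderiv]
      add := fun {σ σ'} hσ hσ' ↦ by
        have e : (fun y ↦ mvfderiv I f y ((σ + σ') y))
            = fun y ↦ mvfderiv I f y (σ y) + mvfderiv I f y (σ' y) := by
          ext1 y; exact map_add _ _ _
        rw [e, mvfderiv_fun_add (mdifferentiableAt_mvfderiv_apply hf hσ)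
          (mdifferentiableAt_mvfderiv_apply hf hσ')]
        simp }
  refine (orthProj_normalSpace hf x _).trans ?_
  exact ht.pointwise (FiberBundle.mdifferentiableAt_extend I E (Y x)) hY (by simp)

theorem form_alpha (hf : IsIsometricImmersion I f) {ξ : Π x : M, normalSpace I f x} {x : M}
    (hξ : MDifferentiableAt I 𝓘(ℝ, Ambient n k) (fun y ↦ (ξ y : Ambient n k)) x)
    (u v : TangentSpace I x) :
    normalForm I f (alpha I f x u v) (ξ x)
      = - form (mvfderiv I (fun y ↦ (ξ y : Ambient n k)) x u) (mvfderiv I f x v) := by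
  have : IsManifold I 1 M := IsManifold.of_le (n := ∞) (by exact_mod_cast le_top)
  have hv := FiberBundle.mdifferentiableAt_extend I E v
  have h1 := alpha_eq hf hv u
  rw [FiberBundle.extend_apply_self] at h1
  rw [h1, normalForm, form_normalPart, form_comm _ (ξ x : Ambient n k)]
  have h2 := mvfderiv_bilinear_apply (formL n k) hξ (mdifferentiableAt_mvfderiv_apply hf hv) u
  have h3 : (fun y ↦ formL n k (ξ y : Ambient n k) (mvfderiv I f y (FiberBundle.extend E v y)))
      = fun _ ↦ (0 : ℝ) := funext fun y ↦ (ξ y).2.2 _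
  rw [h3, mvfderiv_const, FiberBundle.extend_apply_self] at h2
  simp only [zero_apply, formL_apply] at h2
  linarith

/-- The Weingarten formula. -/
theorem shape_eq (hf : IsIsometricImmersion I f) {ξ : Π x : M, normalSpace I f x} {x : M}
    (hξ : MDifferentiableAt I 𝓘(ℝ, Ambient n k) (fun y ↦ (ξ y : Ambient n k)) x)
    (u : TangentSpace I x) :
    shape I f x (ξ x) u
      = - tangentPart I f x (mvfderiv I (fun y ↦ (ξ y : Ambient n k)) x u) :=
  adjoint_eq (fun _ _ ↦ tangentForm_ext) fun v ↦ by
    rw [tangentForm, inner_neg_left, inner_tangentPart, ← form_alpha hf hξ]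
    exact form_comm _ _

end Splitting

noncomputable section Connections

variable {E : Type*} [NormedAddCommGroup E] [NormedSpace ℝ E] [FiniteDimensional ℝ E]
  {H : Type*} [TopologicalSpace H] {I : ModelWithCorners ℝ E H}
  {M : Type*} [TopologicalSpace M] [ChartedSpace H M] [IsManifold I ∞ M]
  [RiemannianBundle (fun x : M ↦ TangentSpace I x)]
  {ℓ : ℕ} {n : Fin ℓ → ℕ} {k : Fin ℓ → ℝ} {f : M → Ambient n k}

theorem contMDiff_mvfderiv_apply {Φ : M → Ambient n k}
    (hΦ : ContMDiff I 𝓘(ℝ, Ambient n k) ∞ Φ) {X : Π x : M, TangentSpace I x}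
    (hX : SmoothField I X) :
    ContMDiff I 𝓘(ℝ, Ambient n k) ∞ (fun y ↦ mvfderiv I Φ y (X y)) := fun x ↦
  contMDiffAt_mvfderiv_apply hΦ (hX x)

theorem contMDiff_proj {Φ : M → Ambient n k} (hΦ : ContMDiff I 𝓘(ℝ, Ambient n k) ∞ Φ)
    (i : Fin ℓ) : ContMDiff I 𝓘(ℝ, Ambient n k) ∞ (fun y ↦ proj i (Φ y)) :=
  (projL i).contMDiff.comp hΦ

theorem contMDiffAt_form {Φ Ψ : M → Ambient n k} {x : M}
    (hΦ : ContMDiffAt I 𝓘(ℝ, Ambient n k) ∞ Φ x) (hΨ : ContMDiffAt I 𝓘(ℝ, Ambient n k) ∞ Ψ x) :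
    ContMDiffAt I 𝓘(ℝ, ℝ) ∞ (fun y ↦ form (Φ y) (Ψ y)) x :=
  ((formL n k).contMDiff.contMDiffAt.comp x hΦ).clm_apply hΨ

theorem mdifferentiableAt_of_contMDiff {Φ : M → Ambient n k}
    (hΦ : ContMDiff I 𝓘(ℝ, Ambient n k) ∞ Φ) (x : M) :
    MDifferentiableAt I 𝓘(ℝ, Ambient n k) Φ x :=
  hΦ.contMDiffAt.mdifferentiableAt (by simp)

theorem contMDiff_normalO (hf : IsIsometricImmersion I f) {Φ : M → Ambient n k}
    (hΦ : ContMDiff I 𝓘(ℝ, Ambient n k) ∞ Φ) :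
    ContMDiff I 𝓘(ℝ, Ambient n k) ∞ (fun y ↦ normalO (f y) (Φ y)) := by
  refine contMDiff_finsetSum fun i _ ↦ ?_
  have h : ContMDiff I 𝓘(ℝ, ℝ) ∞ (fun y ↦ conormal (f y) i (Φ y)) :=
    contMDiff_const.mul fun x ↦ contMDiffAt_form (contMDiff_proj hΦ i x) (hf.contMDiff x)
  exact h.smul (contMDiff_proj hf.contMDiff i)

theorem mvfderiv_sum {ι : Type*} (s : Finset ι) {Φ : ι → M → Ambient n k} {x : M}
    (hΦ : ∀ i, MDifferentiableAt I 𝓘(ℝ, Ambient n k) (Φ i) x) (u : TangentSpace I x) :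
    mvfderiv I (fun y ↦ ∑ i ∈ s, Φ i y) x u = ∑ i ∈ s, mvfderiv I (Φ i) x u := by
  classical
  suffices h : MDifferentiableAt I 𝓘(ℝ, Ambient n k) (fun y ↦ ∑ i ∈ s, Φ i y) x ∧
      mvfderiv I (fun y ↦ ∑ i ∈ s, Φ i y) x u = ∑ i ∈ s, mvfderiv I (Φ i) x u from h.2
  induction s using Finset.induction_on with
  | empty => simpa [mvfderiv_const] using mdifferentiableAt_const
  | insert i s hi ih =>
    simp only [Finset.sum_insert hi]
    exact ⟨(hΦ i).add ih.1, by rw [mvfderiv_fun_add (hΦ i) ih.1, add_apply, ih.2]⟩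

section LeviCivita

variable [IsContMDiffRiemannianBundle I ∞ E (fun x : M ↦ TangentSpace I x)]

theorem smoothField_tangentPart (hf : IsIsometricImmersion I f) {Φ : M → Ambient n k}
    (hΦ : ContMDiff I 𝓘(ℝ, Ambient n k) ∞ Φ) :
    SmoothField I (fun y ↦ tangentPart I f y (Φ y)) := fun x ↦ by
  refine contMDiffAt_of_inner fun s hs ↦ ?_
  simp only [inner_tangentPart]
  exact contMDiffAt_form (hΦ x) (contMDiffAt_mvfderiv_apply hf.contMDiff hs)

theorem contMDiff_normalPart (hf : IsIsometricImmersion I f) {Φ : M → Ambient n k}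
    (hΦ : ContMDiff I 𝓘(ℝ, Ambient n k) ∞ Φ) :
    ContMDiff I 𝓘(ℝ, Ambient n k) ∞ (fun y ↦ (normalPart hf y (Φ y) : Ambient n k)) := by
  simp only [coe_normalPart]
  exact (hΦ.sub (contMDiff_normalO hf hΦ)).sub
    (contMDiff_mvfderiv_apply hf.contMDiff (smoothField_tangentPart hf hΦ))

variable [I.Boundaryless]

/-- The Gauss formula: the tangential component of the derivative of `f_* Y` is given by the
Levi-Civita connection. -/
theorem leviCivita_eq (hf : IsIsometricImmersion I f) {Y : Π x : M, TangentSpace I x} {x : M}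
    (hY : CMDiffAt ∞ (T% Y) x) (u : TangentSpace I x) :
    leviCivita I M Y x u
      = tangentPart I f x (mvfderiv I (fun y ↦ mvfderiv I f y (Y y)) x u) := by
  have : CompleteSpace E := FiniteDimensional.complete ℝ E
  have : IsManifold I 1 M := IsManifold.of_le (n := ∞) (by exact_mod_cast le_top)
  refine ext_inner_right ℝ fun w ↦ ?_
  have key : ∀ {X W : Π x : M, TangentSpace I x}, CMDiffAt ∞ (T% X) x → CMDiffAt ∞ (T% W) x →
      inner ℝ (leviCivita I M Y x (X x)) (W x)
        = form (mvfderiv I (fun y ↦ mvfderiv I f y (Y y)) x (X x)) (mvfderiv I f x (W x)) := by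
    intro X W hX hW
    have hd : ∀ {A : Π x : M, TangentSpace I x}, CMDiffAt ∞ (T% A) x → MDiffAt (T% A) x :=
      fun hA ↦ hA.mdifferentiableAt (by simp)
    have hmet : ∀ {A B : Π x : M, TangentSpace I x}, CMDiffAt ∞ (T% A) x → CMDiffAt ∞ (T% B) x →
        ∀ v, mvfderiv I (fun y ↦ inner ℝ (A y) (B y)) x v
          = form (mvfderiv I (fun y ↦ mvfderiv I f y (A y)) x v) (mvfderiv I f x (B x))
            + form (mvfderiv I f x (A x)) (mvfderiv I (fun y ↦ mvfderiv I f y (B y)) x v) := by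
      intro A B hA hB v
      have e : (fun y ↦ inner ℝ (A y) (B y))
          = fun y ↦ formL n k (mvfderiv I f y (A y)) (mvfderiv I f y (B y)) :=
        funext fun y ↦ (hf.isometric y _ _).symm
      rw [e, mvfderiv_bilinear_apply (formL n k) (mdifferentiableAt_mvfderiv_apply hf (hd hA))
        (mdifferentiableAt_mvfderiv_apply hf (hd hB))]
      rfl
    have hbr : ∀ {A B C : Π x : M, TangentSpace I x}, CMDiffAt ∞ (T% A) x → CMDiffAt ∞ (T% B) x →
        inner ℝ (mlieBracket I A B x) (C x)
          = form (mvfderiv I (fun y ↦ mvfderiv I f y (B y)) x (A x)) (mvfderiv I f x (C x))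
            - form (mvfderiv I (fun y ↦ mvfderiv I f y (A y)) x (B x))
              (mvfderiv I f x (C x)) := by
      intro A B C hA hB
      rw [← form_sub_left, mvfderiv_mlieBracket hf.contMDiff hA hB, hf.isometric]
    refine (inner_leviCivitaFun I (hd hX) (hd hY) (hd hW)).trans ?_
    rw [koszul, hmet hY hW, hmet hX hW, hmet hX hY, hbr hX hY, hbr hX hW, hbr hY hW]
    simp only [form_comm (mvfderiv I f x _)]
    ring
  have h := key (FiberBundle.contMDiffAt_extend I E u) (FiberBundle.contMDiffAt_extend I E w)
  simp only [FiberBundle.extend_apply_self] at h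
  rw [inner_tangentPart, h]

theorem nabla_eq (hf : IsIsometricImmersion I f) (X : Π x : M, TangentSpace I x)
    {Y : Π x : M, TangentSpace I x} (hY : SmoothField I Y) (x : M) :
    nabla I X Y x
      = tangentPart I f x (mvfderiv I (fun y ↦ mvfderiv I f y (Y y)) x (X x)) :=
  leviCivita_eq hf (hY x) _

theorem alpha_comm (hf : IsIsometricImmersion I f) (x : M) (u v : TangentSpace I x) :
    alpha I f x u v = alpha I f x v u := by
  have : CompleteSpace E := FiniteDimensional.complete ℝ E
  have : IsManifold I 1 M := IsManifold.of_le (n := ∞) (by exact_mod_cast le_top)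
  have hu := FiberBundle.contMDiffAt_extend I E u (k := ∞)
  have hv := FiberBundle.contMDiffAt_extend I E v (k := ∞)
  have h := congrArg (normalPart hf x) (mvfderiv_mlieBracket hf.contMDiff hu hv)
  have h1 := alpha_eq hf (hu.mdifferentiableAt (by simp)) v
  have h2 := alpha_eq hf (hv.mdifferentiableAt (by simp)) u
  simp only [FiberBundle.extend_apply_self] at h h1 h2
  rw [map_sub, ← h1, ← h2, normalPart_mvfderiv] at h
  exact sub_eq_zero.mp h

end LeviCivita

end Connections

noncomputable section StructureEquations

variable {E : Type*} [NormedAddCommGroup E] [NormedSpace ℝ E] [FiniteDimensional ℝ E]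
  {H : Type*} [TopologicalSpace H] {I : ModelWithCorners ℝ E H}
  {M : Type*} [TopologicalSpace M] [ChartedSpace H M] [IsManifold I ∞ M]
  [RiemannianBundle (fun x : M ↦ TangentSpace I x)]
  [IsContMDiffRiemannianBundle I ∞ E (fun x : M ↦ TangentSpace I x)]
  {ℓ : ℕ} {n : Fin ℓ → ℕ} {k : Fin ℓ → ℝ} {f : M → Ambient n k}
  {W : Type*} [AddCommGroup W] [Module ℝ W]

/-- A field along `f` that is tangent to `Ô`. -/
def TangentToO (f : M → Ambient n k) (Φ : M → Ambient n k) : Prop :=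
  ∀ y i, conormal (f y) i (Φ y) = 0

theorem tangentToO_mvfderiv (hf : IsIsometricImmersion I f) (Y : Π x : M, TangentSpace I x) :
    TangentToO f (fun y ↦ mvfderiv I f y (Y y)) :=
  fun y i ↦ conormal_mvfderiv_self hf y i (Y y)

theorem tangentToO_normal (hf : IsIsometricImmersion I f) (ξ : Π x : M, normalSpace I f x) :
    TangentToO f (fun y ↦ (ξ y : Ambient n k)) :=
  fun y i ↦ conormal_eq_zero_of_mem hf (ξ y) i

theorem conormal_proj {p v : Ambient n k} (hv : ∀ i, conormal p i v = 0) (i j : Fin ℓ) :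
    conormal p j (proj i v) = 0 := by
  rcases eq_or_ne j i with rfl | h
  · rw [conormal, proj_proj]; exact hv j
  · rw [conormal, proj_proj_of_ne h, form_zero_left, mul_zero]

theorem map_mvfderiv_proj (hf : IsIsometricImmersion I f) {x : M} (P : Ambient n k →ₗ[ℝ] W)
    (hP : ∀ i, k i • P (proj i (f x)) = 0) {Φ : M → Ambient n k}
    (hΦ : ContMDiff I 𝓘(ℝ, Ambient n k) ∞ Φ) (hΦO : TangentToO f Φ) (i : Fin ℓ)
    (u : TangentSpace I x) :
    P (mvfderiv I (fun y ↦ mvfderiv I f y (tangentPart I f y (proj i (Φ y)))) x u)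
      + P (mvfderiv I (fun y ↦ (normalPart hf y (proj i (Φ y)) : Ambient n k)) x u)
      = P (proj i (mvfderiv I f x (tangentPart I f x (mvfderiv I Φ x u))))
        + P (proj i (normalPart hf x (mvfderiv I Φ x u) : Ambient n k)) := by
  have hp := contMDiff_proj hΦ i
  have h1 : (fun y ↦ projL i (Φ y)) = fun y ↦
      mvfderiv I f y (tangentPart I f y (proj i (Φ y)))
        + (normalPart hf y (proj i (Φ y)) : Ambient n k) := by
    ext1 y
    have h0 : normalO (f y) (proj i (Φ y)) = 0 :=
      Finset.sum_eq_zero fun j _ ↦ by rw [conormal_proj (hΦO y), zero_smul]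
    conv_lhs => rw [projL_apply, splitting hf y (proj i (Φ y)), h0, add_zero]
  have h2 := mvfderiv_clm_comp_apply (projL i) (mdifferentiableAt_of_contMDiff hΦ x) u
  rw [h1, mvfderiv_fun_add
    (mdifferentiableAt_of_contMDiff (contMDiff_mvfderiv_apply hf.contMDiff
      (smoothField_tangentPart hf hp)) x)
    (mdifferentiableAt_of_contMDiff (contMDiff_normalPart hf hp) x), projL_apply, add_apply] at h2
  have h3 := congrArg (fun w ↦ P (proj i w)) (splitting hf x (mvfderiv I Φ x u))
  have h4 : P (proj i (normalO (f x) (mvfderiv I Φ x u))) = 0 := by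
    rw [proj_normalO, conormal, mul_comm, mul_smul, map_smul, map_smul, hP, smul_zero]
  simp only [map_add, h4, add_zero] at h3
  rw [← h3, ← h2, map_add]

theorem map_mvfderiv_mvfderiv (hf : IsIsometricImmersion I f) {x : M} (P : Ambient n k →ₗ[ℝ] W)
    (hP : ∀ i, k i • P (proj i (f x)) = 0) {Φ : M → Ambient n k}
    (hΦ : ContMDiff I 𝓘(ℝ, Ambient n k) ∞ Φ) (hΦO : TangentToO f Φ)
    {Y : Π x : M, TangentSpace I x} (hY : SmoothField I Y) (u : TangentSpace I x) :
    P (mvfderiv I (fun y ↦ mvfderiv I Φ y (Y y)) x u)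
      = P (mvfderiv I (fun y ↦ mvfderiv I f y (tangentPart I f y (mvfderiv I Φ y (Y y)))) x u)
        + P (mvfderiv I (fun y ↦ (normalPart hf y (mvfderiv I Φ y (Y y)) : Ambient n k)) x u)
        - ∑ i, k i • form (Φ x) (proj i (mvfderiv I f x (Y x))) •
            P (proj i (mvfderiv I f x u)) := by
  have hD := contMDiff_mvfderiv_apply hΦ hY
  let h : Fin ℓ → M → ℝ := fun i y ↦ - form (Φ y) (proj i (mvfderiv I f y (Y y)))
  have hh : ∀ i, ContMDiff I 𝓘(ℝ, ℝ) ∞ (h i) := fun i x ↦ ContMDiffAt.neg <|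
    contMDiffAt_form (hΦ x) (contMDiff_proj (contMDiff_mvfderiv_apply hf.contMDiff hY) i x)
  let c : Fin ℓ → M → Ambient n k := fun i y ↦ h i y • (k i • projL i) (f y)
  have hc : ∀ i, MDifferentiableAt I 𝓘(ℝ, Ambient n k) (c i) x := fun i ↦
    mdifferentiableAt_of_contMDiff ((hh i).smul ((k i • projL i).contMDiff.comp hf.contMDiff)) x
  let a : M → Ambient n k := fun y ↦ mvfderiv I f y (tangentPart I f y (mvfderiv I Φ y (Y y)))
  let b : M → Ambient n k := fun y ↦ (normalPart hf y (mvfderiv I Φ y (Y y)) : Ambient n k)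
  have hsum : (fun y ↦ mvfderiv I Φ y (Y y)) = fun y ↦ (a y + b y) + ∑ i, c i y := by
    ext1 y
    refine (splitting hf y (mvfderiv I Φ y (Y y))).trans (congrArg (a y + b y + ·) ?_)
    refine Finset.sum_congr rfl fun i _ ↦ ?_
    rw [conormal_mvfderiv hf (mdifferentiableAt_of_contMDiff hΦ y) (hΦO · i)]
    simp only [c, h, smul_apply, projL_apply, neg_smul, smul_smul, mul_comm, mul_neg]
  have ha : MDifferentiableAt I 𝓘(ℝ, Ambient n k) a x := mdifferentiableAt_of_contMDiff
    (contMDiff_mvfderiv_apply hf.contMDiff (smoothField_tangentPart hf hD)) x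
  have hb : MDifferentiableAt I 𝓘(ℝ, Ambient n k) b x :=
    mdifferentiableAt_of_contMDiff (contMDiff_normalPart hf hD) x
  have hab : MDifferentiableAt I 𝓘(ℝ, Ambient n k) (fun y ↦ a y + b y) x := ha.add hb
  have hcs : MDifferentiableAt I 𝓘(ℝ, Ambient n k) (fun y ↦ ∑ i, c i y) x :=
    mdifferentiableAt_of_contMDiff (contMDiff_finsetSum fun i _ ↦
      (hh i).smul ((k i • projL i).contMDiff.comp hf.contMDiff)) x
  conv_lhs => rw [hsum]
  rw [mvfderiv_fun_add hab hcs, mvfderiv_fun_add ha hb, add_apply, add_apply,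
    mvfderiv_sum _ hc, map_add, map_add, map_sum, sub_eq_add_neg, ← Finset.sum_neg_distrib]
  refine congrArg (P (mvfderiv I a x u) + P (mvfderiv I b x u) + ·) ?_
  refine Finset.sum_congr rfl fun i _ ↦ ?_
  have h1 := mvfderiv_clm_comp_apply (k i • projL i) (hf.mdifferentiableAt x) u
  have h2 : MDifferentiableAt I 𝓘(ℝ, Ambient n k) (fun y ↦ (k i • projL i) (f y)) x :=
    mdifferentiableAt_of_contMDiff ((k i • projL i).contMDiff.comp hf.contMDiff) x
  have h3 := mvfderiv_fun_smul ((hh i).contMDiffAt.mdifferentiableAt (by simp)) h2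
  have h4 : mvfderiv I (c i) x u = h i x • (k i • projL i) (mvfderiv I f x u)
      + mvfderiv I (h i) x u • (k i • projL i) (f x) := by
    rw [← h1]
    exact congrArg (fun A : TangentSpace I x →L[ℝ] Ambient n k ↦ A u) h3
  rw [h4]
  simp only [smul_apply, projL_apply, map_add, map_smul, hP, smul_zero, add_zero, h, neg_smul]
  rw [smul_comm, map_neg, map_smul, map_smul]

/-- The flatness of `ℝ^N`, expressed through the splitting. -/
theorem map_structure_equation (hf : IsIsometricImmersion I f) {x : M}
    (P : Ambient n k →ₗ[ℝ] W) (hP : ∀ i, k i • P (proj i (f x)) = 0) {Φ : M → Ambient n k}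
    (hΦ : ContMDiff I 𝓘(ℝ, Ambient n k) ∞ Φ) (hΦO : TangentToO f Φ)
    {X Y : Π x : M, TangentSpace I x} (hX : SmoothField I X) (hY : SmoothField I Y)
    [I.Boundaryless] :
    P (mvfderiv I (fun y ↦ mvfderiv I f y (tangentPart I f y (mvfderiv I Φ y (Y y)))) x (X x))
        + P (mvfderiv I (fun y ↦ (normalPart hf y (mvfderiv I Φ y (Y y)) : Ambient n k)) x (X x))
      - P (mvfderiv I (fun y ↦ mvfderiv I f y (tangentPart I f y (mvfderiv I Φ y (X y)))) x (Y x))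
        - P (mvfderiv I (fun y ↦ (normalPart hf y (mvfderiv I Φ y (X y)) : Ambient n k)) x (Y x))
      - P (mvfderiv I Φ x (mlieBracket I X Y x))
      = ∑ i, k i • (form (Φ x) (proj i (mvfderiv I f x (Y x))) • P (proj i (mvfderiv I f x (X x)))
          - form (Φ x) (proj i (mvfderiv I f x (X x))) • P (proj i (mvfderiv I f x (Y x)))) := by
  have : CompleteSpace E := FiniteDimensional.complete ℝ E
  rw [← mvfderiv_mlieBracket hΦ (hX x) (hY x), map_sub,
    map_mvfderiv_mvfderiv hf P hP hΦ hΦO hY, map_mvfderiv_mvfderiv hf P hP hΦ hΦO hX]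
  simp only [smul_sub, Finset.sum_sub_distrib]
  abel

end StructureEquations

noncomputable section FundamentalEquations

variable {E : Type*} [NormedAddCommGroup E] [NormedSpace ℝ E] [FiniteDimensional ℝ E]
  {H : Type*} [TopologicalSpace H] {I : ModelWithCorners ℝ E H} [I.Boundaryless]
  {M : Type*} [TopologicalSpace M] [ChartedSpace H M] [IsManifold I ∞ M]
  [RiemannianBundle (fun x : M ↦ TangentSpace I x)]
  [IsContMDiffRiemannianBundle I ∞ E (fun x : M ↦ TangentSpace I x)]
  {ℓ : ℕ} {n : Fin ℓ → ℕ} {k : Fin ℓ → ℝ} {f : M → Ambient n k}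
  {X Y Z : Π x : M, TangentSpace I x} {ξ : Π x : M, normalSpace I f x}

theorem mdiffAt_of_smoothField (hX : SmoothField I X) (x : M) : MDiffAt (T% X) x :=
  (hX x).mdifferentiableAt (by simp)

theorem alpha_apply (hf : IsIsometricImmersion I f) (hY : SmoothField I Y) (x : M)
    (u : TangentSpace I x) :
    alpha I f x u (Y x) = normalPart hf x (mvfderiv I (fun y ↦ mvfderiv I f y (Y y)) x u) :=
  alpha_eq hf (mdiffAt_of_smoothField hY x) u

theorem shape_normalPart (hf : IsIsometricImmersion I f) {Φ : M → Ambient n k}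
    (hΦ : ContMDiff I 𝓘(ℝ, Ambient n k) ∞ Φ) (x : M) (u : TangentSpace I x) :
    shape I f x (normalPart hf x (Φ x)) u
      = - tangentPart I f x (mvfderiv I (fun y ↦ (normalPart hf y (Φ y) : Ambient n k)) x u) :=
  shape_eq hf (ξ := fun y ↦ normalPart hf y (Φ y))
    (mdifferentiableAt_of_contMDiff (contMDiff_normalPart hf hΦ) x) u

theorem nabla_tangentPart (hf : IsIsometricImmersion I f) (X : Π x : M, TangentSpace I x)
    {Φ : M → Ambient n k} (hΦ : ContMDiff I 𝓘(ℝ, Ambient n k) ∞ Φ) (x : M) :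
    nabla I X (fun y ↦ tangentPart I f y (Φ y)) x = tangentPart I f x
      (mvfderiv I (fun y ↦ mvfderiv I f y (tangentPart I f y (Φ y))) x (X x)) :=
  nabla_eq hf X (smoothField_tangentPart hf hΦ) x

theorem alpha_tangentPart (hf : IsIsometricImmersion I f) {Φ : M → Ambient n k}
    (hΦ : ContMDiff I 𝓘(ℝ, Ambient n k) ∞ Φ) (x : M) (u : TangentSpace I x) :
    alpha I f x u (tangentPart I f x (Φ x)) = normalPart hf x
      (mvfderiv I (fun y ↦ mvfderiv I f y (tangentPart I f y (Φ y))) x u) :=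
  alpha_apply hf (Y := fun y ↦ tangentPart I f y (Φ y)) (smoothField_tangentPart hf hΦ) x u

theorem nablaPerp_normalPart (hf : IsIsometricImmersion I f) (X : Π x : M, TangentSpace I x)
    (Φ : M → Ambient n k) (x : M) :
    nablaPerp I f X (fun y ↦ normalPart hf y (Φ y)) x = normalPart hf x
      (mvfderiv I (fun y ↦ (normalPart hf y (Φ y) : Ambient n k)) x (X x)) :=
  nablaPerp_eq hf X _ x

theorem shape_apply (hf : IsIsometricImmersion I f) (hξ : SmoothNormal I f ξ) (x : M)
    (u : TangentSpace I x) :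
    shape I f x (ξ x) u
      = - tangentPart I f x (mvfderiv I (fun y ↦ (ξ y : Ambient n k)) x u) :=
  shape_eq hf (mdifferentiableAt_of_contMDiff hξ x) u

theorem nabla_sub_nabla (hX : SmoothField I X) (hY : SmoothField I Y) (x : M) :
    mlieBracket I X Y x = nabla I X Y x - nabla I Y X x :=
  (leviCivita_torsion I (mdiffAt_of_smoothField hX x) (mdiffAt_of_smoothField hY x)).symm

theorem alpha_sub_left (hf : IsIsometricImmersion I f) (hZ : SmoothField I Z) (x : M)
    (u v : TangentSpace I x) :
    alpha I f x (u - v) (Z x) = alpha I f x u (Z x) - alpha I f x v (Z x) := by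
  simp only [alpha_apply hf hZ, map_sub]

theorem shape_sub (hf : IsIsometricImmersion I f) (hξ : SmoothNormal I f ξ) (x : M)
    (u v : TangentSpace I x) :
    shape I f x (ξ x) (u - v) = shape I f x (ξ x) u - shape I f x (ξ x) v := by
  simp only [shape_apply hf hξ, map_sub]
  abel

theorem shape_adjoint (hf : IsIsometricImmersion I f) (hξ : SmoothNormal I f ξ) (x : M)
    (u v : TangentSpace I x) :
    normalForm I f (alpha I f x u v) (ξ x) = tangentForm I (shape I f x (ξ x) u) v := by
  rw [shape_apply hf hξ, tangentForm, inner_neg_left, inner_tangentPart,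
    form_alpha hf (mdifferentiableAt_of_contMDiff hξ x)]

theorem shape_symm (hf : IsIsometricImmersion I f) (hξ : SmoothNormal I f ξ) (x : M)
    (u v : TangentSpace I x) :
    tangentForm I (shape I f x (ξ x) u) v = tangentForm I (shape I f x (ξ x) v) u := by
  rw [← shape_adjoint hf hξ, alpha_comm hf, shape_adjoint hf hξ]

theorem mvfderiv_mvfderiv_shape (hf : IsIsometricImmersion I f)
    (hξ : SmoothNormal I f ξ) (x : M) (u : TangentSpace I x) :
    mvfderiv I (fun y ↦ mvfderiv I f y (shape I f y (ξ y) (X y))) x u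
      = - mvfderiv I (fun y ↦ mvfderiv I f y (tangentPart I f y
          (mvfderiv I (fun z ↦ (ξ z : Ambient n k)) y (X y)))) x u := by
  simp only [shape_apply hf hξ, map_neg]
  rw [mvfderiv_fun_neg]
  rfl

theorem smoothField_shape (hf : IsIsometricImmersion I f) (hX : SmoothField I X)
    (hξ : SmoothNormal I f ξ) : SmoothField I (fun y ↦ shape I f y (ξ y) (X y)) := by
  have h := smoothField_tangentPart hf (contMDiff_mvfderiv_apply hξ hX).neg
  simpa only [shape_apply hf hξ, Pi.neg_apply, map_neg] using h

theorem nabla_shape (hf : IsIsometricImmersion I f) (Y : Π x : M, TangentSpace I x)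
    (hX : SmoothField I X) (hξ : SmoothNormal I f ξ) (x : M) :
    nabla I Y (fun y ↦ shape I f y (ξ y) (X y)) x
      = - tangentPart I f x (mvfderiv I (fun y ↦ mvfderiv I f y (tangentPart I f y
          (mvfderiv I (fun z ↦ (ξ z : Ambient n k)) y (X y)))) x (Y x)) := by
  rw [nabla_eq hf Y (smoothField_shape hf hX hξ), mvfderiv_mvfderiv_shape hf hξ, map_neg]

theorem alpha_shape (hf : IsIsometricImmersion I f) (hX : SmoothField I X)
    (hξ : SmoothNormal I f ξ) (x : M) (u : TangentSpace I x) :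
    alpha I f x u (shape I f x (ξ x) (X x))
      = - normalPart hf x (mvfderiv I (fun y ↦ mvfderiv I f y (tangentPart I f y
          (mvfderiv I (fun z ↦ (ξ z : Ambient n k)) y (X y)))) x u) := by
  rw [← map_neg, ← mvfderiv_mvfderiv_shape hf hξ]
  exact alpha_apply hf (smoothField_shape hf hX hξ) x u

theorem nablaPerp_fun_eq (hf : IsIsometricImmersion I f) (X : Π x : M, TangentSpace I x)
    (ξ : Π x : M, normalSpace I f x) :
    nablaPerp I f X ξ
      = fun x ↦ normalPart hf x (mvfderiv I (fun y ↦ (ξ y : Ambient n k)) x (X x)) :=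
  funext (nablaPerp_eq hf X ξ)

/-! ### The covariant derivatives of the tensors -/

theorem covR_eq (hf : IsIsometricImmersion I f) (hY : SmoothField I Y) (i : Fin ℓ) (x : M) :
    covR I f i X Y x
      = shape I f x (tensorS I f i x (Y x)) (X x)
        + tensorSt I f i x (alpha I f x (X x) (Y x)) := by
  have hL := contMDiff_mvfderiv_apply hf.contMDiff hY
  have h := map_mvfderiv_proj hf (tangentPart I f x) (tangentPart_proj_base hf x) hL
    (tangentToO_mvfderiv hf Y) i (X x)
  simp only [covR, tensorR_eq]
  rw [tensorS_eq hf, tensorSt_eq hf, alpha_apply hf hY, nabla_eq hf X hY,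
    nabla_tangentPart hf X (contMDiff_proj hL i),
    shape_normalPart hf (contMDiff_proj hL i), eq_sub_of_add_eq h]
  abel

theorem covS_eq (hf : IsIsometricImmersion I f) (hY : SmoothField I Y) (i : Fin ℓ) (x : M) :
    covS I f i X Y x
      = tensorT I f i x (alpha I f x (X x) (Y x))
        - alpha I f x (X x) (tensorR I f i x (Y x)) := by
  have hL := contMDiff_mvfderiv_apply hf.contMDiff hY
  have h := map_mvfderiv_proj hf (normalPart hf x) (normalPart_proj_base hf x) hL
    (tangentToO_mvfderiv hf Y) i (X x)
  simp only [covS, tensorS_eq hf]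
  rw [tensorT_eq hf, tensorR_eq, alpha_apply hf hY, nabla_eq hf X hY,
    nablaPerp_normalPart hf X, alpha_tangentPart hf (contMDiff_proj hL i), eq_sub_of_add_eq h]
  abel

theorem covSt_eq (hf : IsIsometricImmersion I f) (hξ : SmoothNormal I f ξ) (i : Fin ℓ) (x : M) :
    covSt I f i X ξ x
      = shape I f x (tensorT I f i x (ξ x)) (X x)
        - tensorR I f i x (shape I f x (ξ x) (X x)) := by
  have h := map_mvfderiv_proj hf (tangentPart I f x) (tangentPart_proj_base hf x) hξ
    (tangentToO_normal hf ξ) i (X x)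
  simp only [covSt, tensorSt_eq hf]
  rw [tensorT_eq hf, tensorR_eq, shape_apply hf hξ, nablaPerp_eq hf,
    nabla_tangentPart hf X (contMDiff_proj hξ i),
    shape_normalPart hf (contMDiff_proj hξ i), eq_sub_of_add_eq h]
  simp only [map_neg]
  abel

theorem covT_eq (hf : IsIsometricImmersion I f) (hξ : SmoothNormal I f ξ) (i : Fin ℓ) (x : M) :
    covT I f i X ξ x
      = - tensorS I f i x (shape I f x (ξ x) (X x))
        - alpha I f x (X x) (tensorSt I f i x (ξ x)) := by
  have h := map_mvfderiv_proj hf (normalPart hf x) (normalPart_proj_base hf x) hξ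
    (tangentToO_normal hf ξ) i (X x)
  simp only [covT, tensorT_eq hf]
  rw [tensorS_eq hf, tensorSt_eq hf, shape_apply hf hξ, nablaPerp_eq hf X ξ,
    nablaPerp_normalPart hf X, alpha_tangentPart hf (contMDiff_proj hξ i), eq_sub_of_add_eq' h]
  simp only [map_neg]
  abel

/-! ### The Gauss, Codazzi and Ricci equations -/

theorem tangentForm_tensorR (i : Fin ℓ) (x : M) (u v : TangentSpace I x) :
    tangentForm I (tensorR I f i x u) v = form (mvfderiv I f x v) (proj i (mvfderiv I f x u)) := by
  rw [tensorR_eq, tangentForm, inner_tangentPart, form_comm]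

theorem normalForm_tensorS (hf : IsIsometricImmersion I f) (i : Fin ℓ) (x : M)
    (u : TangentSpace I x) (η : normalSpace I f x) :
    normalForm I f (tensorS I f i x u) η = form (η : Ambient n k) (proj i (mvfderiv I f x u)) := by
  rw [tensorS_eq hf, normalForm, form_normalPart, form_comm]

theorem nabla_fun_eq (hf : IsIsometricImmersion I f) (X : Π x : M, TangentSpace I x)
    (hY : SmoothField I Y) :
    nabla I X Y = fun x ↦
      tangentPart I f x (mvfderiv I (fun y ↦ mvfderiv I f y (Y y)) x (X x)) :=
  funext (nabla_eq hf X hY)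

theorem gauss_equation (hf : IsIsometricImmersion I f) (hX : SmoothField I X)
    (hY : SmoothField I Y) (hZ : SmoothField I Z) (x : M) :
    curvature I X Y Z x
      = ∑ i, k i • wedge (tangentForm I) (tensorR I f i x (X x)) (tensorR I f i x (Y x)) (Z x)
        + shape I f x (alpha I f x (Y x) (Z x)) (X x)
        - shape I f x (alpha I f x (X x) (Z x)) (Y x) := by
  have hL := contMDiff_mvfderiv_apply hf.contMDiff hZ
  have h := map_structure_equation hf (tangentPart I f x) (tangentPart_proj_base hf x) hL
    (tangentToO_mvfderiv hf Z) hX hY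
  simp only [wedge, tangentForm_tensorR]
  simp only [tensorR_eq, alpha_apply hf hZ]
  rw [← h, curvature, nabla_fun_eq hf Y hZ, nabla_fun_eq hf X hZ,
    nabla_tangentPart hf X (contMDiff_mvfderiv_apply hL hY),
    nabla_tangentPart hf Y (contMDiff_mvfderiv_apply hL hX), nabla_eq hf _ hZ,
    shape_normalPart hf (contMDiff_mvfderiv_apply hL hY),
    shape_normalPart hf (contMDiff_mvfderiv_apply hL hX)]
  abel

theorem codazzi_equation (hf : IsIsometricImmersion I f) (hX : SmoothField I X)
    (hY : SmoothField I Y) (hZ : SmoothField I Z) (x : M) :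
    covAlpha I f X Y Z x - covAlpha I f Y X Z x
      = ∑ i, k i • (tangentForm I (tensorR I f i x (Y x)) (Z x) • tensorS I f i x (X x)
          - tangentForm I (tensorR I f i x (X x)) (Z x) • tensorS I f i x (Y x)) := by
  have hL := contMDiff_mvfderiv_apply hf.contMDiff hZ
  have h := map_structure_equation hf (normalPart hf x) (normalPart_proj_base hf x) hL
    (tangentToO_mvfderiv hf Z) hX hY
  rw [← alpha_apply hf hZ, nabla_sub_nabla hX hY, alpha_sub_left hf hZ,
    ← alpha_tangentPart hf (contMDiff_mvfderiv_apply hL hY),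
    ← alpha_tangentPart hf (contMDiff_mvfderiv_apply hL hX), ← nabla_eq hf _ hZ,
    ← nabla_eq hf _ hZ, ← nablaPerp_normalPart hf X, ← nablaPerp_normalPart hf Y] at h
  simp only [tangentForm_tensorR, tensorS_eq hf]
  rw [← h]
  simp only [covAlpha, alpha_apply hf hZ]
  abel

theorem codazzi_equation_shape (hf : IsIsometricImmersion I f) (hX : SmoothField I X)
    (hY : SmoothField I Y) (hξ : SmoothNormal I f ξ) (x : M) :
    covShape I f Y X ξ x - covShape I f X Y ξ x
      = ∑ i, k i • (normalForm I f (tensorS I f i x (Y x)) (ξ x) • tensorR I f i x (X x)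
          - normalForm I f (tensorS I f i x (X x)) (ξ x) • tensorR I f i x (Y x)) := by
  have h := map_structure_equation hf (tangentPart I f x) (tangentPart_proj_base hf x) hξ
    (tangentToO_normal hf ξ) hX hY
  have hbr := shape_sub hf hξ x (nabla I X Y x) (nabla I Y X x)
  rw [← nabla_sub_nabla hX hY, shape_apply hf hξ] at hbr
  simp only [normalForm_tensorS hf, tensorR_eq]
  rw [← h, covShape, covShape, nabla_shape hf Y hX hξ, nabla_shape hf X hY hξ,
    nablaPerp_eq hf, nablaPerp_eq hf, shape_normalPart hf (contMDiff_mvfderiv_apply hξ hX),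
    shape_normalPart hf (contMDiff_mvfderiv_apply hξ hY), sub_eq_add_neg _ (tangentPart I f x
      (mvfderiv I (fun y ↦ (ξ y : Ambient n k)) x (mlieBracket I X Y x))), hbr]
  abel

theorem ricci_equation (hf : IsIsometricImmersion I f) (hX : SmoothField I X)
    (hY : SmoothField I Y) (hξ : SmoothNormal I f ξ) (x : M) :
    curvaturePerp I f X Y ξ x
      = alpha I f x (X x) (shape I f x (ξ x) (Y x))
        - alpha I f x (shape I f x (ξ x) (X x)) (Y x)
        + ∑ i, k i •
          wedge (normalForm I f) (tensorS I f i x (X x)) (tensorS I f i x (Y x)) (ξ x) := by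
  have h := map_structure_equation hf (normalPart hf x) (normalPart_proj_base hf x) hξ
    (tangentToO_normal hf ξ) hX hY
  simp only [wedge, normalForm_tensorS hf]
  simp only [tensorS_eq hf]
  rw [← h, curvaturePerp, nablaPerp_fun_eq hf Y ξ, nablaPerp_fun_eq hf X ξ,
    nablaPerp_normalPart hf X, nablaPerp_normalPart hf Y, nablaPerp_eq hf,
    alpha_comm hf x (shape I f x (ξ x) (X x)), alpha_shape hf hY hξ, alpha_shape hf hX hξ]
  abel

theorem normalForm_ricci_equation (hf : IsIsometricImmersion I f) (hX : SmoothField I X)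
    (hY : SmoothField I Y) (hξ : SmoothNormal I f ξ) {ζ : Π x : M, normalSpace I f x}
    (hζ : SmoothNormal I f ζ) (x : M) :
    normalForm I f (curvaturePerp I f X Y ξ x) (ζ x)
      = tangentForm I
          (shape I f x (ξ x) (shape I f x (ζ x) (X x))
            - shape I f x (ζ x) (shape I f x (ξ x) (X x))) (Y x)
        + normalForm I f
            (∑ i, k i • wedge (normalForm I f)
              (tensorS I f i x (X x)) (tensorS I f i x (Y x)) (ξ x)) (ζ x) := by
  rw [ricci_equation hf hX hY hξ]
  have hadd : ∀ a b c : normalSpace I f x,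
      normalForm I f (a - b + c) (ζ x)
        = normalForm I f a (ζ x) - normalForm I f b (ζ x) + normalForm I f c (ζ x) := by
    intro a b c
    simp only [normalForm, Submodule.coe_add, Submodule.coe_sub, form_add_left, form_sub_left]
  rw [hadd, shape_adjoint hf hζ, shape_adjoint hf hζ, tangentForm, tangentForm, tangentForm,
    inner_sub_left]
  congr 2
  rw [real_inner_comm]
  exact shape_symm hf hξ x _ _

end FundamentalEquations

end SpaceFormProduct

theorem lemma2p10
    {E : Type*} [NormedAddCommGroup E] [NormedSpace ℝ E] [FiniteDimensional ℝ E]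
    {H : Type*} [TopologicalSpace H] (I : ModelWithCorners ℝ E H) [I.Boundaryless]
    {M : Type*} [TopologicalSpace M] [ChartedSpace H M] [IsManifold I ∞ M]
    [RiemannianBundle (fun x : M ↦ TangentSpace I x)]
    [IsContMDiffRiemannianBundle I ∞ E (fun x : M ↦ TangentSpace I x)]
    {ℓ : ℕ} (n : Fin ℓ → ℕ) (k : Fin ℓ → ℝ)
    (f : M → Ambient n k) (hf : IsIsometricImmersion I f)
    (X Y Z : Π x : M, TangentSpace I x)
    (hX : SmoothField I X) (hY : SmoothField I Y) (hZ : SmoothField I Z)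
    (ξ ζ : Π x : M, normalSpace I f x)
    (hξ : SmoothNormal I f ξ) (hζ : SmoothNormal I f ζ) (x : M) :
    -- the covariant derivatives of the tensors
    (∀ i,
      covR I f i X Y x
          = shape I f x (tensorS I f i x (Y x)) (X x)
            + tensorSt I f i x (alpha I f x (X x) (Y x))
      ∧ covS I f i X Y x
          = tensorT I f i x (alpha I f x (X x) (Y x))
            - alpha I f x (X x) (tensorR I f i x (Y x))
      ∧ covSt I f i X ξ x
          = shape I f x (tensorT I f i x (ξ x)) (X x)
            - tensorR I f i x (shape I f x (ξ x) (X x))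
      ∧ covT I f i X ξ x
          = - tensorS I f i x (shape I f x (ξ x) (X x))
            - alpha I f x (X x) (tensorSt I f i x (ξ x)))
    -- the Gauss equation
    ∧ curvature I X Y Z x
        = ∑ i, k i • wedge (tangentForm I) (tensorR I f i x (X x)) (tensorR I f i x (Y x)) (Z x)
          + shape I f x (alpha I f x (Y x) (Z x)) (X x)
          - shape I f x (alpha I f x (X x) (Z x)) (Y x)
    -- the two forms of the Codazzi equation
    ∧ covAlpha I f X Y Z x - covAlpha I f Y X Z x
        = ∑ i, k i • (tangentForm I (tensorR I f i x (Y x)) (Z x) • tensorS I f i x (X x)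
            - tangentForm I (tensorR I f i x (X x)) (Z x) • tensorS I f i x (Y x))
    ∧ covShape I f Y X ξ x - covShape I f X Y ξ x
        = ∑ i, k i • (normalForm I f (tensorS I f i x (Y x)) (ξ x) • tensorR I f i x (X x)
            - normalForm I f (tensorS I f i x (X x)) (ξ x) • tensorR I f i x (Y x))
    -- the two forms of the Ricci equation
    ∧ curvaturePerp I f X Y ξ x
        = alpha I f x (X x) (shape I f x (ξ x) (Y x))
          - alpha I f x (shape I f x (ξ x) (X x)) (Y x)
          + ∑ i, k i • wedge (normalForm I f) (tensorS I f i x (X x)) (tensorS I f i x (Y x)) (ξ x)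
    ∧ normalForm I f (curvaturePerp I f X Y ξ x) (ζ x)
        = tangentForm I
            (shape I f x (ξ x) (shape I f x (ζ x) (X x))
              - shape I f x (ζ x) (shape I f x (ξ x) (X x))) (Y x)
          + normalForm I f
              (∑ i, k i • wedge (normalForm I f)
                (tensorS I f i x (X x)) (tensorS I f i x (Y x)) (ξ x)) (ζ x) := by
  exact ⟨fun i ↦ ⟨covR_eq hf hY i x, covS_eq hf hY i x, covSt_eq hf hξ i x, covT_eq hf hξ i x⟩,
    gauss_equation hf hX hY hZ x, codazzi_equation hf hX hY hZ x,
    codazzi_equation_shape hf hX hY hξ x, ricci_equation hf hX hY hξ x,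
    normalForm_ricci_equation hf hX hY hξ hζ x⟩
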